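/- **Corollary 5.6 (horizontal classes).** For $n\ge 0$ let $\Gamma(B_n)$ be the graph whose vertices are the permutations of $\{1,\dots,n\}$ (equivalently, the maximal chains of the Boolean lattice $B_n$), with $\sigma,\tau$ adjacent iff $\tau=\sigma s_i$ for some simple transposition $s_i=(i\ i{+}1)$, $1\le i\le n-1$. For a graph $\Gamma$ with base vertex $v_0$ let $A_1^G(\Gamma,v_0)$ be its discrete fundamental group: based loops, i.e. maps $f:\{0,1,2,\dots\}\to V(\Gamma)$ with $f(0)=v_0$, $f(m)=v_0$ for all large $m$, and $f(i),f(i+1)$ equal or adjacent for all $i$, modulo $G$-homotopy, with concatenation as product. (Two loops are $G$-homotopic if they are the first and the last row of a finite grid of vertices all of whose rows are based loops and in which vertically neighbouring entries are equal or adjacent.) Write $A_1^G(\Gamma,v_0)^{ab}$ for its abelianization. A *primitive 6-cycle* of $\Gamma(B_n)$ is a 6-cycle whose edges are labelled by two consecutive transpositions $s_j,s_{j+1}$. For $n\ge1$ the *level* of $\sigma$ is $\sigma^{-1}(n)$. A primitive 6-cycle is *horizontal* if all its vertices are at the same level, and *vertical* if it has two vertices in each of three consecutive levels. The *class* of a 6-cycle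 $C$ in $A_1^G(\Gamma(B_n),\sigma_0)^{ab}$ is the class of $PCP^{-1}$, where $P$ is a path from $\sigma_0$ to $C$. Let $n\ge 1$, let $\sigma_0\in S_n$ and $\rho_0\in S_{n-1}$ be arbitrary base vertices, and let $V$ be the subgroup of $A_1^G(\Gamma(B_n),\sigma_0)^{ab}$ generated by the classes of the vertical 6-cycles. Then the number of horizontal classes of $A_1^G(\Gamma(B_n),\sigma_0)^{ab}$, counted up to those that can be expressed through other horizontal classes and vertical ones, is equal to the rank of $A_1^G(\Gamma(B_{n-1}),\rho_0)^{ab}$. Precisely, call a set $S$ of classes of horizontal 6-cycles a *horizontal system* if it is linearly independent over $\mathbb Z$ modulo $V$ and the class of every horizontal 6-cycle is an integral combination of elements of $S$ and of classes of vertical 6-cycles. Then: 1. there is a horizontal system $S$ consisting of classes of horizontal 6-cycles at level $n$, such that the class of every horizontal 6-cycle at level $n$ is an integral combination of elements of $S$; 2. every horizontal system is finite, and its number of elements is $\operatorname{rank} A_1^G(\Gamma(B_{n-1}),\rho_0)^{ab}$. -/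

import Mathlib

open scoped SimpleGraph

namespace AHomotopy

/-! Discrete homotopy of graphs: the group `A₁ᴳ(Γ, v₀)`. -/

/-- A graph map sends adjacent vertices to vertices which are adjacent or equal. -/
def IsGraphMap {V W : Type*} (G : SimpleGraph V) (H : SimpleGraph W) (f : V → W) : Prop :=
  ∀ ⦃v w : V⦄, G.Adj v w → H.Adj (f v) (f w) ∨ f v = f w

/-- The infinite path `I` on the vertices `0, 1, 2, …`. -/
abbrev infPath : SimpleGraph ℕ := SimpleGraph.hasse ℕ

/-- `f` starts at `v₀` and is eventually equal to `v₀`. -/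
def IsBased {V : Type*} (v₀ : V) (f : ℕ → V) : Prop :=
  f 0 = v₀ ∧ ∃ N : ℕ, ∀ m, N ≤ m → f m = v₀

/-- Based loops: graph maps `f : I → Γ` with `f 0 = v₀` and `f m = v₀` for all large `m`. -/
structure BasedLoop {V : Type*} (Γ : SimpleGraph V) (v₀ : V) where
  toFun : ℕ → V
  isGraphMap : IsGraphMap infPath Γ toFun
  isBased : IsBased v₀ toFun

/-- `G`-homotopy of based loops: a graph map `F : I □ I_n → Γ` whose first row is `f`, whose last
row is `g`, and each of whose rows is a loop based at `v₀`. -/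
def GHomotopic {V : Type*} {Γ : SimpleGraph V} {v₀ : V} (f g : BasedLoop Γ v₀) : Prop :=
  ∃ (n : ℕ) (F : ℕ × Fin (n + 1) → V),
    IsGraphMap (infPath □ SimpleGraph.pathGraph (n + 1)) Γ F ∧
    (∀ i, F (i, 0) = f.toFun i) ∧ (∀ i, F (i, Fin.last n) = g.toFun i) ∧
    ∀ j, IsBased v₀ (fun i => F (i, j))

section Aux

variable {V : Type*} {Γ : SimpleGraph V} {v₀ : V}

/-- Adjacent or equal. -/
def AE (Γ : SimpleGraph V) (v w : V) : Prop := Γ.Adj v w ∨ v = w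

theorem AE.symm {v w : V} (h : AE Γ v w) : AE Γ w v :=
  h.elim (fun h => Or.inl h.symm) (fun h => Or.inr h.symm)

theorem AE.rfl' (v : V) : AE Γ v v := Or.inr rfl

theorem isGraphMap_infPath_iff {f : ℕ → V} :
    IsGraphMap infPath Γ f ↔ ∀ i, AE Γ (f i) (f (i + 1)) := by
  constructor
  · intro h i
    exact h (by simp [SimpleGraph.hasse_adj, Nat.covBy_iff_add_one_eq])
  · intro h v w hvw
    rw [SimpleGraph.hasse_adj, Nat.covBy_iff_add_one_eq, Nat.covBy_iff_add_one_eq] at hvw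
    rcases hvw with rfl | rfl
    · exact h v
    · exact (h w).symm

theorem BasedLoop.ext' {f g : BasedLoop Γ v₀} (h : ∀ i, f.toFun i = g.toFun i) : f = g := by
  cases f; cases g
  congr
  exact funext h

theorem BasedLoop.ae (f : BasedLoop Γ v₀) (i : ℕ) : AE Γ (f.toFun i) (f.toFun (i + 1)) :=
  isGraphMap_infPath_iff.1 f.isGraphMap i

theorem BasedLoop.zero (f : BasedLoop Γ v₀) : f.toFun 0 = v₀ := f.isBased.1

/-- Two consecutive rows of a homotopy. -/
def Step (f g : BasedLoop Γ v₀) : Prop := ∀ i, AE Γ (f.toFun i) (g.toFun i)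

theorem Step.symm {f g : BasedLoop Γ v₀} (h : Step f g) : Step g f := fun i => (h i).symm

theorem GHomotopic.rfl' (f : BasedLoop Γ v₀) : GHomotopic f f := by
  refine ⟨0, fun p => f.toFun p.1, ?_, fun _ => rfl, fun _ => rfl, fun _ => f.isBased⟩
  rintro ⟨a, b⟩ ⟨c, d⟩ h
  rw [SimpleGraph.boxProd_adj] at h
  rcases h with ⟨h, -⟩ | ⟨-, h⟩
  · exact f.isGraphMap h
  · exact Or.inr (congrArg f.toFun h)

theorem GHomotopic.snoc {f g h : BasedLoop Γ v₀} (hfg : GHomotopic f g) (hgh : Step g h) :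
    GHomotopic f h := by
  obtain ⟨n, F, hF, h0, h1, hb⟩ := hfg
  refine ⟨n + 1, fun p => if hp : p.2.1 < n + 1 then F (p.1, ⟨p.2.1, hp⟩) else h.toFun p.1,
    ?_, ?_, ?_, ?_⟩
  · have key : ∀ (i j : ℕ) (hj : j < n + 1), ¬ j + 1 < n + 1 →
        AE Γ (F (i, ⟨j, hj⟩)) (h.toFun i) := by
      intro i j hj hj'
      have : (⟨j, hj⟩ : Fin (n + 1)) = Fin.last n := Fin.ext (by simp; omega)
      rw [this, h1]
      exact hgh i
    have col : ∀ (i j : ℕ) (hj : j < n + 1) (hj' : j + 1 < n + 1),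
        AE Γ (F (i, ⟨j, hj⟩)) (F (i, ⟨j + 1, hj'⟩)) := by
      intro i j hj hj'
      apply hF
      rw [SimpleGraph.boxProd_adj, SimpleGraph.pathGraph_adj]
      simp
    rintro ⟨a, b, hb⟩ ⟨c, d, hd⟩ hadj
    rw [SimpleGraph.boxProd_adj, SimpleGraph.pathGraph_adj] at hadj
    simp only [Fin.mk.injEq] at hadj
    change AE Γ _ _
    rcases hadj with ⟨hac, rfl⟩ | ⟨hbd, rfl⟩
    · dsimp only
      split_ifs with hb'
      · apply hF
        rw [SimpleGraph.boxProd_adj]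
        exact Or.inl ⟨hac, rfl⟩
      · exact h.isGraphMap hac
    · rcases hbd with rfl | rfl
      · dsimp only
        have hb' : b < n + 1 := by omega
        rw [dif_pos hb']
        split_ifs with hd'
        · exact col _ _ _ _
        · exact key _ _ _ hd'
      · dsimp only
        have hb' : d < n + 1 := by omega
        rw [dif_pos hb']
        split_ifs with hd'
        · exact (col _ _ _ _).symm
        · exact (key _ _ _ hd').symm
  · intro i
    simpa using h0 i
  · intro i
    simp
  · intro j
    by_cases hj : j.1 < n + 1
    · simpa [hj] using hb ⟨j.1, hj⟩
    · simpa [hj] using h.isBased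

theorem gHomotopic_iff (f g : BasedLoop Γ v₀) :
    GHomotopic f g ↔ Relation.ReflTransGen Step f g := by
  constructor
  · rintro ⟨n, F, hF, h0, h1, hb⟩
    let R : Fin (n + 1) → BasedLoop Γ v₀ := fun j =>
      ⟨fun i => F (i, j), fun v w hvw => hF (by
        rw [SimpleGraph.boxProd_adj]; exact Or.inl ⟨hvw, rfl⟩), hb j⟩
    have hf : R 0 = f := BasedLoop.ext' h0
    have hg : R (Fin.last n) = g := BasedLoop.ext' h1
    rw [← hf, ← hg]
    have : ∀ (j : ℕ) (hj : j < n + 1), Relation.ReflTransGen Step (R 0) (R ⟨j, hj⟩) := by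
      intro j
      induction j with
      | zero => exact fun _ => Relation.ReflTransGen.refl
      | succ j ih =>
        intro hj
        refine (ih (by omega)).tail ?_
        intro i
        apply hF
        rw [SimpleGraph.boxProd_adj, SimpleGraph.pathGraph_adj]
        simp
    exact this n (Nat.lt_succ_self n)
  · intro h
    induction h with
    | refl => exact GHomotopic.rfl' f
    | tail _ h ih => exact ih.snoc h

theorem Step.homotopic {f g : BasedLoop Γ v₀} (h : Step f g) : GHomotopic f g :=
  (gHomotopic_iff f g).2 (Relation.ReflTransGen.single h)

theorem GHomotopic.trans' {f g h : BasedLoop Γ v₀} (h₁ : GHomotopic f g) (h₂ : GHomotopic g h) :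
    GHomotopic f h := by
  rw [gHomotopic_iff] at *
  exact h₁.trans h₂

theorem GHomotopic.symm' {f g : BasedLoop Γ v₀} (h : GHomotopic f g) : GHomotopic g f := by
  rw [gHomotopic_iff] at *
  induction h with
  | refl => exact Relation.ReflTransGen.refl
  | tail _ h ih => exact Relation.ReflTransGen.head h.symm ih

/-- From index `N` on, the loop `f` stays at the base vertex. -/
def Stable (f : BasedLoop Γ v₀) (N : ℕ) : Prop := ∀ m, N ≤ m → f.toFun m = v₀

theorem Stable.mono {f : BasedLoop Γ v₀} {N M : ℕ} (h : Stable f N) (hNM : N ≤ M) : Stable f M :=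
  fun m hm => h m (hNM.trans hm)

end Aux

section Group

variable {V : Type*} {Γ : SimpleGraph V} {v₀ : V}

/-- First run through `f` up to time `N`, then through `g`. -/
def BasedLoop.concatAt (f g : BasedLoop Γ v₀) (N : ℕ) (hN : Stable f N) : BasedLoop Γ v₀ where
  toFun i := if i ≤ N then f.toFun i else g.toFun (i - N)
  isGraphMap := by
    rw [isGraphMap_infPath_iff]
    intro i
    rcases lt_trichotomy i N with h | rfl | h
    · rw [if_pos h.le, if_pos (by omega)]
      exact f.ae i
    · rw [if_pos le_rfl, if_neg (by omega), hN i le_rfl]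
      simpa [g.zero] using g.ae 0
    · rw [if_neg (by omega), if_neg (by omega), show i + 1 - N = (i - N) + 1 by omega]
      exact g.ae _
  isBased := by
    refine ⟨by simp [f.zero], ?_⟩
    obtain ⟨M, hM⟩ := g.isBased.2
    refine ⟨N + M + 1, fun m hm => ?_⟩
    change (if m ≤ N then f.toFun m else g.toFun (m - N)) = v₀
    rw [if_neg (by omega)]
    exact hM _ (by omega)

/-- Run through `f` backwards, starting from time `N`. -/
def BasedLoop.reverseAt (f : BasedLoop Γ v₀) (N : ℕ) (hN : Stable f N) : BasedLoop Γ v₀ where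
  toFun i := f.toFun (N - i)
  isGraphMap := by
    rw [isGraphMap_infPath_iff]
    intro i
    by_cases h : i < N
    · rw [show N - i = (N - (i + 1)) + 1 by omega]
      exact (f.ae _).symm
    · rw [show N - i = 0 by omega, show N - (i + 1) = 0 by omega]
      exact AE.rfl' _
  isBased := by
    refine ⟨hN _ (by simp), N, fun m hm => ?_⟩
    change f.toFun (N - m) = v₀
    rw [show N - m = 0 by omega]
    exact f.zero

/-- The constant loop. -/
def BasedLoop.const (Γ : SimpleGraph V) (v₀ : V) : BasedLoop Γ v₀ where
  toFun _ := v₀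
  isGraphMap := fun _ _ _ => Or.inr rfl
  isBased := ⟨rfl, 0, fun _ _ => rfl⟩

theorem concatAt_indep {f g : BasedLoop Γ v₀} {N M : ℕ} (hN : Stable f N) (hM : Stable f M) :
    GHomotopic (f.concatAt g N hN) (f.concatAt g M hM) := by
  have key : ∀ (k N : ℕ) (hN : Stable f N) (hM : Stable f (N + k)),
      GHomotopic (f.concatAt g N hN) (f.concatAt g (N + k) hM) := by
    intro k
    induction k with
    | zero => exact fun _ _ _ => GHomotopic.rfl' _
    | succ k ih =>
      intro N hN hM
      have hk : Stable f (N + k) := hN.mono (by omega)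
      refine (ih N hN hk).snoc ?_
      intro i
      simp only [BasedLoop.concatAt]
      rcases lt_trichotomy i (N + k + 1) with h | rfl | h
      · rw [if_pos (by omega), if_pos (by omega)]
        exact AE.rfl' _
      · rw [if_neg (by omega), if_pos (by omega), hN (N + k + 1) (by omega)]
        simpa [g.zero] using (g.ae 0).symm
      · rw [if_neg (by omega), if_neg (by omega),
          show i - (N + k) = (i - (N + (k + 1))) + 1 by omega]
        exact (g.ae _).symm
  rcases le_total N M with h | h
  · obtain ⟨k, rfl⟩ := Nat.exists_eq_add_of_le h
    exact key k N hN hM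
  · obtain ⟨k, rfl⟩ := Nat.exists_eq_add_of_le h
    exact (key k M hM hN).symm'

theorem reverseAt_indep {f : BasedLoop Γ v₀} {N M : ℕ} (hN : Stable f N) (hM : Stable f M) :
    GHomotopic (f.reverseAt N hN) (f.reverseAt M hM) := by
  have key : ∀ (k N : ℕ) (hN : Stable f N) (hM : Stable f (N + k)),
      GHomotopic (f.reverseAt N hN) (f.reverseAt (N + k) hM) := by
    intro k
    induction k with
    | zero => exact fun _ _ _ => GHomotopic.rfl' _
    | succ k ih =>
      intro N hN hM
      have hk : Stable f (N + k) := hN.mono (by omega)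
      refine (ih N hN hk).snoc ?_
      intro i
      simp only [BasedLoop.reverseAt]
      by_cases h : i ≤ N + k
      · rw [show N + (k + 1) - i = (N + k - i) + 1 by omega]
        exact f.ae _
      · rw [show N + (k + 1) - i = 0 by omega, show N + k - i = 0 by omega]
        exact AE.rfl' _
  rcases le_total N M with h | h
  · obtain ⟨k, rfl⟩ := Nat.exists_eq_add_of_le h
    exact key k N hN hM
  · obtain ⟨k, rfl⟩ := Nat.exists_eq_add_of_le h
    exact (key k M hM hN).symm'

/-- A time `N_f` from which on the loop stays at the base vertex. -/
noncomputable def BasedLoop.endTime (f : BasedLoop Γ v₀) : ℕ := f.isBased.2.choose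

theorem BasedLoop.endTime_stable (f : BasedLoop Γ v₀) : Stable f f.endTime := f.isBased.2.choose_spec

/-- Concatenation of based loops. -/
noncomputable def BasedLoop.concat (f g : BasedLoop Γ v₀) : BasedLoop Γ v₀ :=
  f.concatAt g f.endTime f.endTime_stable

/-- The reverse of a based loop. -/
noncomputable def BasedLoop.reverse (f : BasedLoop Γ v₀) : BasedLoop Γ v₀ :=
  f.reverseAt f.endTime f.endTime_stable

theorem concat_congr_step_left {f f' : BasedLoop Γ v₀} (g : BasedLoop Γ v₀) (h : Step f f') :
    GHomotopic (f.concat g) (f'.concat g) := by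
  have h₁ := f.endTime_stable.mono (le_max_left f.endTime f'.endTime)
  have h₂ := f'.endTime_stable.mono (le_max_right f.endTime f'.endTime)
  refine (concatAt_indep _ h₁).trans' (GHomotopic.trans' (Step.homotopic ?_) (concatAt_indep h₂ _))
  intro i
  simp only [BasedLoop.concatAt]
  split_ifs
  · exact h i
  · exact AE.rfl' _

theorem concat_congr_step_right (f : BasedLoop Γ v₀) {g g' : BasedLoop Γ v₀} (h : Step g g') :
    GHomotopic (f.concat g) (f.concat g') := by
  refine Step.homotopic ?_
  intro i
  simp only [BasedLoop.concat, BasedLoop.concatAt]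
  split_ifs
  · exact AE.rfl' _
  · exact h _

theorem reverse_congr_step {f f' : BasedLoop Γ v₀} (h : Step f f') :
    GHomotopic f.reverse f'.reverse := by
  have h₁ := f.endTime_stable.mono (le_max_left f.endTime f'.endTime)
  have h₂ := f'.endTime_stable.mono (le_max_right f.endTime f'.endTime)
  refine (reverseAt_indep _ h₁).trans'
    (GHomotopic.trans' (Step.homotopic ?_) (reverseAt_indep h₂ _))
  exact fun i => h _

/-- `G`-homotopy as an equivalence relation on based loops. -/
instance loopSetoid (Γ : SimpleGraph V) (v₀ : V) : Setoid (BasedLoop Γ v₀) where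
  r := GHomotopic
  iseqv := ⟨GHomotopic.rfl', GHomotopic.symm', GHomotopic.trans'⟩

theorem concat_congr {f f' g g' : BasedLoop Γ v₀} (h : GHomotopic f f') (h' : GHomotopic g g') :
    GHomotopic (f.concat g) (f'.concat g') := by
  refine GHomotopic.trans' (g := f'.concat g) ?_ ?_
  · rw [gHomotopic_iff] at h
    induction h with
    | refl => exact GHomotopic.rfl' _
    | tail _ h ih => exact ih.trans' (concat_congr_step_left _ h)
  · rw [gHomotopic_iff] at h'
    induction h' with
    | refl => exact GHomotopic.rfl' _
    | tail _ h ih => exact ih.trans' (concat_congr_step_right _ h)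

theorem reverse_congr {f f' : BasedLoop Γ v₀} (h : GHomotopic f f') :
    GHomotopic f.reverse f'.reverse := by
  rw [gHomotopic_iff] at h
  induction h with
  | refl => exact GHomotopic.rfl' _
  | tail _ h ih => exact ih.trans' (reverse_congr_step h)

theorem concatAt_stable {f g : BasedLoop Γ v₀} {N M : ℕ} (hN : Stable f N) (hM : Stable g M) :
    Stable (f.concatAt g N hN) (N + M) := by
  intro m hm
  simp only [BasedLoop.concatAt]
  split_ifs with h
  · exact hN _ (by omega)
  · exact hM _ (by omega)

theorem concat_assoc (f g h : BasedLoop Γ v₀) :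
    GHomotopic ((f.concat g).concat h) (f.concat (g.concat h)) := by
  have hs := concatAt_stable f.endTime_stable g.endTime_stable
  have e : (f.concat g).concatAt h (f.endTime + g.endTime) hs = f.concat (g.concat h) := by
    apply BasedLoop.ext'
    intro i
    simp only [BasedLoop.concat, BasedLoop.concatAt]
    by_cases h1 : i ≤ f.endTime
    · rw [if_pos (by omega), if_pos h1, if_pos h1]
    · by_cases h2 : i ≤ f.endTime + g.endTime
      · rw [if_pos h2, if_neg h1, if_neg h1, if_pos (by omega)]
      · rw [if_neg h2, if_neg h1, if_neg (by omega), Nat.sub_sub]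
  rw [← e]
  exact concatAt_indep _ hs

theorem const_concat (f : BasedLoop Γ v₀) :
    GHomotopic ((BasedLoop.const Γ v₀).concat f) f := by
  have hs : Stable (BasedLoop.const Γ v₀) 0 := fun _ _ => rfl
  have e : (BasedLoop.const Γ v₀).concatAt f 0 hs = f := by
    apply BasedLoop.ext'
    intro i
    simp only [BasedLoop.concatAt, BasedLoop.const]
    split_ifs with h
    · rw [Nat.le_zero.1 h, f.zero]
    · simp
  have := concatAt_indep (g := f) (BasedLoop.const Γ v₀).endTime_stable hs
  rwa [e] at this

theorem concat_const (f : BasedLoop Γ v₀) :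
    GHomotopic (f.concat (BasedLoop.const Γ v₀)) f := by
  have e : f.concat (BasedLoop.const Γ v₀) = f := by
    apply BasedLoop.ext'
    intro i
    simp only [BasedLoop.concat, BasedLoop.concatAt, BasedLoop.const]
    split_ifs with h
    · rfl
    · exact (f.endTime_stable i (by omega)).symm
  rw [e]
  exact GHomotopic.rfl' f

theorem reverseAt_stable {f : BasedLoop Γ v₀} {N : ℕ} (hN : Stable f N) :
    Stable (f.reverseAt N hN) N := by
  intro m hm
  change f.toFun (N - m) = v₀
  rw [show N - m = 0 by omega, f.zero]

/-- The loop that runs through `f` up to time `k`, waits until time `2N - k`, and runs back. -/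
def BasedLoop.fold (f : BasedLoop Γ v₀) (N k : ℕ) : BasedLoop Γ v₀ where
  toFun i := f.toFun (min (min i (2 * N - i)) k)
  isGraphMap := by
    rw [isGraphMap_infPath_iff]
    intro i
    have : min (min (i + 1) (2 * N - (i + 1))) k = min (min i (2 * N - i)) k ∨
        min (min (i + 1) (2 * N - (i + 1))) k = min (min i (2 * N - i)) k + 1 ∨
        min (min (i + 1) (2 * N - (i + 1))) k + 1 = min (min i (2 * N - i)) k := by omega
    rcases this with h | h | h
    · rw [h]; exact AE.rfl' _
    · rw [h]; exact f.ae _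
    · rw [← h]; exact (f.ae _).symm
  isBased := by
    refine ⟨by simp [f.zero], 2 * N, fun m hm => ?_⟩
    change f.toFun (min (min m (2 * N - m)) k) = v₀
    rw [show min (min m (2 * N - m)) k = 0 by omega, f.zero]

theorem concat_reverse (f : BasedLoop Γ v₀) :
    GHomotopic (f.concat f.reverse) (BasedLoop.const Γ v₀) := by
  have e : f.concat f.reverse = f.fold f.endTime f.endTime := by
    apply BasedLoop.ext'
    intro i
    simp only [BasedLoop.concat, BasedLoop.concatAt, BasedLoop.reverse, BasedLoop.reverseAt,
      BasedLoop.fold]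
    split_ifs with h
    · rw [show min (min i (2 * f.endTime - i)) f.endTime = i by omega]
    · rw [show min (min i (2 * f.endTime - i)) f.endTime = f.endTime - (i - f.endTime) by omega]
  rw [e]
  have key : ∀ k, GHomotopic (f.fold f.endTime k) (BasedLoop.const Γ v₀) := by
    intro k
    induction k with
    | zero =>
      have e0 : f.fold f.endTime 0 = BasedLoop.const Γ v₀ :=
        BasedLoop.ext' fun i => by simp [BasedLoop.fold, BasedLoop.const, f.zero]
      rw [e0]
      exact GHomotopic.rfl' _
    | succ k ih =>
      refine GHomotopic.trans' (Step.homotopic ?_) ih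
      intro i
      simp only [BasedLoop.fold]
      generalize min i (2 * f.endTime - i) = a
      have : min a (k + 1) = min a k ∨ min a (k + 1) = min a k + 1 := by omega
      rcases this with h | h
      · rw [h]; exact AE.rfl' _
      · rw [h]; exact (f.ae _).symm
  exact key _

theorem reverse_concat (f : BasedLoop Γ v₀) :
    GHomotopic (f.reverse.concat f) (BasedLoop.const Γ v₀) := by
  have hs : Stable f.reverse f.endTime := reverseAt_stable f.endTime_stable
  have e : f.reverse.reverseAt f.endTime hs = f := by
    apply BasedLoop.ext'
    intro i
    simp only [BasedLoop.reverseAt, BasedLoop.reverse]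
    by_cases h : i ≤ f.endTime
    · rw [show f.endTime - (f.endTime - i) = i by omega]
    · rw [show f.endTime - (f.endTime - i) = f.endTime by omega, f.endTime_stable _ le_rfl,
        f.endTime_stable i (by omega)]
  have h1 : GHomotopic f.reverse.reverse f := by
    have := reverseAt_indep f.reverse.endTime_stable hs
    rwa [e] at this
  exact (concat_congr (GHomotopic.rfl' _) h1.symm').trans' (concat_reverse f.reverse)

end Group

/-- The discrete fundamental group `A₁ᴳ(Γ, v₀)`: based loops up to `G`-homotopy. -/
def A1 {V : Type*} (Γ : SimpleGraph V) (v₀ : V) : Type _ := Quotient (loopSetoid Γ v₀)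

/-- The group structure on `A₁ᴳ(Γ, v₀)`, given by concatenation of loops. -/
noncomputable instance {V : Type*} (Γ : SimpleGraph V) (v₀ : V) : Group (A1 Γ v₀) where
  mul := Quotient.map₂ BasedLoop.concat (fun _ _ h _ _ h' => concat_congr h h')
  one := Quotient.mk _ (BasedLoop.const Γ v₀)
  inv := Quotient.map BasedLoop.reverse (fun _ _ h => reverse_congr h)
  mul_assoc a b c := by
    induction a using Quotient.ind
    induction b using Quotient.ind
    induction c using Quotient.ind
    exact Quotient.sound (concat_assoc _ _ _)
  one_mul a := by
    induction a using Quotient.ind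
    exact Quotient.sound (const_concat _)
  mul_one a := by
    induction a using Quotient.ind
    exact Quotient.sound (concat_const _)
  inv_mul_cancel a := by
    induction a using Quotient.ind
    exact Quotient.sound (reverse_concat _)

/-- The abelianization `A₁ᴳ(Γ, v₀)ᵃᵇ`, written additively, so that it is a `ℤ`-module. -/
abbrev A1ab {V : Type*} (Γ : SimpleGraph V) (v₀ : V) : Type _ :=
  Additive (Abelianization (A1 Γ v₀))

/-- The class in `A₁ᴳ(Γ, v₀)ᵃᵇ` of a based loop. -/
noncomputable def BasedLoop.abClass {V : Type*} {Γ : SimpleGraph V} {v₀ : V} (f : BasedLoop Γ v₀) :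
    A1ab Γ v₀ :=
  Additive.ofMul (Abelianization.of (Quotient.mk _ f : A1 Γ v₀))

/-- A closed walk at `v₀` as a based loop (`getVert i` is the end of the walk for large `i`). -/
def loopOfWalk {V : Type*} {Γ : SimpleGraph V} {v₀ : V} (p : Γ.Walk v₀ v₀) : BasedLoop Γ v₀ where
  toFun := p.getVert
  isGraphMap := by
    rw [isGraphMap_infPath_iff]
    intro i
    by_cases h : i < p.length
    · exact Or.inl (p.adj_getVert_succ h)
    · exact Or.inr (by
        rw [p.getVert_of_length_le (by omega), p.getVert_of_length_le (by omega)])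
  isBased := ⟨p.getVert_zero, p.length, fun _ hm => p.getVert_of_length_le hm⟩

/-! The graph of the Boolean lattice and its `6`-cycles. -/

/-- The graph `Γ(B_n)`, the `1`-skeleton of the permutahedron: its vertices are the permutations of
`n` letters (maximal chains of `B_n`), and `σ`, `τ` are adjacent iff `τ = σ sᵢ` for a
simple transposition `sᵢ = (i i+1)`. -/
def boolGraph (n : ℕ) : SimpleGraph (Equiv.Perm (Fin n)) where
  Adj σ τ := ∃ i j : Fin n, i.val + 1 = j.val ∧ τ = σ * Equiv.swap i j
  symm := ⟨by
    rintro σ τ ⟨i, j, hij, rfl⟩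
    exact ⟨i, j, hij, by simp⟩⟩
  loopless := ⟨by
    rintro σ ⟨i, j, hij, h⟩
    have h1 : Equiv.swap i j = 1 := by simpa using h
    rw [Equiv.swap_eq_one_iff] at h1
    subst h1
    omega⟩

/-- A primitive `6`-cycle of `Γ(B_n)`: a cycle of length `6` whose edges are labelled by two
consecutive simple transpositions `(a b)`, `(b c)`, where `b = a + 1` and `c = b + 1`. -/
def IsPrimitiveSixCycle {n : ℕ} {σ : Equiv.Perm (Fin n)} (C : (boolGraph n).Walk σ σ) : Prop :=
  C.IsCycle ∧ C.length = 6 ∧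
    ∃ a b c : Fin n, a.val + 1 = b.val ∧ b.val + 1 = c.val ∧
      ∀ d ∈ C.darts, d.snd = d.fst * Equiv.swap a b ∨ d.snd = d.fst * Equiv.swap b c

/-- The level of a permutation of `n = m + 1` letters: the position of the largest letter. -/
def level {m : ℕ} (σ : Equiv.Perm (Fin (m + 1))) : Fin (m + 1) := σ⁻¹ (Fin.last m)

/-- A horizontal `6`-cycle at level `l`: all its vertices are at level `l`. -/
def IsHorizontalAt {m : ℕ} (l : Fin (m + 1)) {σ : Equiv.Perm (Fin (m + 1))}
    (C : (boolGraph (m + 1)).Walk σ σ) : Prop :=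
  IsPrimitiveSixCycle C ∧ ∀ v ∈ C.support, level v = l

/-- A horizontal `6`-cycle: all its vertices are at the same level. -/
def IsHorizontal {m : ℕ} {σ : Equiv.Perm (Fin (m + 1))}
    (C : (boolGraph (m + 1)).Walk σ σ) : Prop :=
  ∃ l, IsHorizontalAt l C

/-- A vertical `6`-cycle: it has two vertices in each of three consecutive levels. -/
def IsVertical {m : ℕ} {σ : Equiv.Perm (Fin (m + 1))}
    (C : (boolGraph (m + 1)).Walk σ σ) : Prop :=
  IsPrimitiveSixCycle C ∧ ∃ l : ℕ, ∀ k ∈ ({l, l + 1, l + 2} : Set ℕ),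
    {v | v ∈ C.support ∧ (level v).val = k}.ncard = 2

/-- The classes `[P C P⁻¹]` in `A₁ᴳ(Γ(B_n), σ₀)ᵃᵇ` of the `6`-cycles `C` with a given property,
where `P` is a path from the base vertex `σ₀` to `C`. -/
def cycleClasses {n : ℕ} (σ₀ : Equiv.Perm (Fin n))
    (Q : ∀ σ : Equiv.Perm (Fin n), (boolGraph n).Walk σ σ → Prop) :
    Set (A1ab (boolGraph n) σ₀) :=
  {x | ∃ (σ : Equiv.Perm (Fin n)) (P : (boolGraph n).Walk σ₀ σ) (C : (boolGraph n).Walk σ σ),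
    Q σ C ∧ x = (loopOfWalk ((P.append C).append P.reverse)).abClass}

/-- The equivalence classes of horizontal `6`-cycles in `A₁ᴳ(Γ(B_n), σ₀)ᵃᵇ`, `n = m + 1`. -/
def horizontalClasses {m : ℕ} (σ₀ : Equiv.Perm (Fin (m + 1))) :
    Set (A1ab (boolGraph (m + 1)) σ₀) :=
  cycleClasses σ₀ fun _ C => IsHorizontal C

/-- The equivalence classes of the horizontal `6`-cycles at the top level `n = m + 1`. -/
def topHorizontalClasses {m : ℕ} (σ₀ : Equiv.Perm (Fin (m + 1))) :
    Set (A1ab (boolGraph (m + 1)) σ₀) :=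
  cycleClasses σ₀ fun _ C => IsHorizontalAt (Fin.last m) C

/-- The subgroup of `A₁ᴳ(Γ(B_n), σ₀)ᵃᵇ` generated by the classes of the vertical `6`-cycles. -/
noncomputable def verticalSpan {m : ℕ} (σ₀ : Equiv.Perm (Fin (m + 1))) :
    Submodule ℤ (A1ab (boolGraph (m + 1)) σ₀) :=
  Submodule.span ℤ (cycleClasses σ₀ fun _ C => IsVertical C)

/-- `S` is a system of horizontal classes which represents all horizontal classes without
redundancy once the vertical ones are given: it is linearly independent modulo the
vertical classes, and every horizontal class is an integral combination of elements
of `S` and of vertical classes. -/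
def IsHorizontalSystem {m : ℕ} (σ₀ : Equiv.Perm (Fin (m + 1)))
    (S : Set (A1ab (boolGraph (m + 1)) σ₀)) : Prop :=
  S ⊆ horizontalClasses σ₀ ∧
  LinearIndepOn ℤ (verticalSpan σ₀).mkQ S ∧
  horizontalClasses σ₀ ⊆ (Submodule.span ℤ S ⊔ verticalSpan σ₀ : Submodule ℤ _)

end AHomotopy

/-! Write `m = n - 1`. Erasing the largest letter maps `Γ(B_n)` to `Γ(B_m)`, and appending it at the
last position embeds `Γ(B_m)` as level `n`. They induce homomorphisms `retr` and `incl` on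
abelianized groups with `retr ∘ incl = id`. Erasure collapses a vertical hexagon to an edge, so
`retr` kills `V` (`retr_eq_zero`). Conversely, modulo vertical hexagons every edge can be pushed up
to level `n`, so `z - incl (retr z)` lies in `V` (`push_adj`, `sub_incl_retr_mem`). Hence `V = ker
retr`, and the quotient by `V` is the group of `Γ(B_m)` (`quotientEquiv`).

A horizontal system is independent modulo `V`. It also generates modulo `V`, because the classes at
level `n` already do. So it becomes a basis of the quotient, and its size is the rank. Such a system
exists because the group of `Γ(B_m)` has a finite basis of hexagon classes (`exists_hexagon_basis`).
This goes by induction on the number of letters: the group is the direct sum of its vertical part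
and the included group of the smaller graph. The vertical part has a basis of hexagons. A vertical
hexagon depends, up to sign, only on its two exchanged letters and the set of letters before them
(`walkSum_vertHex_congr`), and for each such type a cocycle counting crossings separates it from the
others (`dualCocycle_vertHex`).

Everything is computed with cocycles: functions on pairs of vertices whose sum around every closed
walk of length at most four vanishes. They integrate to homomorphisms on the abelianized group. A
universal cocycle with values in that group (`integ_univ`) turns the class of `P C P⁻¹` into a sum
along `C`, independent of `P`. -/

namespace AHomotopy

/-! ### Cocycles on a graph and their integrals along loops -/

section Cocycle

variable {V : Type*} {Γ : SimpleGraph V} {v₀ : V} {M : Type*} [AddCommGroup M]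

/-- A function on pairs of vertices which vanishes on the diagonal and whose sum along each closed
walk of length at most `4` is zero. -/
structure IsCocycle (Γ : SimpleGraph V) (c : V → V → M) : Prop where
  diag : ∀ a, c a a = 0
  square : ∀ {a b b' d}, AE Γ a b → AE Γ b b' → AE Γ b' d → AE Γ d a →
    c a b + c b b' + c b' d + c d a = 0

theorem IsCocycle.antisymm {c : V → V → M} (hc : IsCocycle Γ c) {a b : V} (h : AE Γ a b) :
    c b a = - c a b := by
  have := hc.square h h.symm (AE.rfl' a) (AE.rfl' a)
  rw [hc.diag, add_zero, add_zero] at this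
  exact (neg_eq_of_add_eq_zero_right this).symm

theorem IsCocycle.comp {W : Type*} {Δ : SimpleGraph W} {c : W → W → M} (hc : IsCocycle Δ c)
    {g : V → W} (hg : ∀ {a b}, AE Γ a b → AE Δ (g a) (g b)) :
    IsCocycle Γ (fun a b => c (g a) (g b)) :=
  ⟨fun _ => hc.diag _, fun h1 h2 h3 h4 => hc.square (hg h1) (hg h2) (hg h3) (hg h4)⟩

theorem IsCocycle.map {N : Type*} [AddCommGroup N] {c : V → V → M} (hc : IsCocycle Γ c)
    (q : M →ₗ[ℤ] N) : IsCocycle Γ (fun a b => q (c a b)) :=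
  ⟨fun a => by simp [hc.diag], fun h1 h2 h3 h4 => by
    rw [← map_add, ← map_add, ← map_add, hc.square h1 h2 h3 h4, map_zero]⟩

/-- The sum of `c` along the first `N` steps of `f`. -/
def pathSum (c : V → V → M) (f : ℕ → V) (N : ℕ) : M := ∑ i ∈ Finset.range N, c (f i) (f (i + 1))

/-- Two neighbouring rows of a homotopy bound a strip of squares, each of sum zero. The extra term
is the rung at time `N`; it vanishes once both loops have stopped. -/
theorem IsCocycle.pathSum_step {c : V → V → M} (hc : IsCocycle Γ c) {f g : BasedLoop Γ v₀}
    (h : Step f g) (N : ℕ) :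
    pathSum c f.toFun N + c (f.toFun N) (g.toFun N) = pathSum c g.toFun N := by
  induction N with
  | zero => simp [pathSum, f.zero, g.zero, hc.diag]
  | succ N ih =>
    have h1 := hc.square (f.ae N) (h (N + 1)) (g.ae N).symm (h N).symm
    rw [hc.antisymm (g.ae N), hc.antisymm (h N)] at h1
    rw [pathSum, pathSum, Finset.sum_range_succ, Finset.sum_range_succ]
    change pathSum c f.toFun N + _ + _ = pathSum c g.toFun N + _
    rw [← ih, ← sub_eq_zero, ← h1]
    abel

theorem IsCocycle.pathSum_stable {c : V → V → M} (hc : IsCocycle Γ c) {f : BasedLoop Γ v₀}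
    {N K : ℕ} (h : Stable f N) (h' : Stable f K) :
    pathSum c f.toFun N = pathSum c f.toFun K := by
  have key : ∀ {N K}, N ≤ K → Stable f N → pathSum c f.toFun N = pathSum c f.toFun K := by
    intro N K hNK hN
    refine Finset.sum_subset (Finset.range_subset_range.2 hNK) fun i _ hi => ?_
    have hi : N ≤ i := by simpa using hi
    rw [hN i hi, hN (i + 1) (by omega), hc.diag]
  rcases le_total N K with hNK | hNK
  · exact key hNK h
  · exact (key hNK h').symm

theorem IsCocycle.pathSum_homotopic {c : V → V → M} (hc : IsCocycle Γ c) {f g : BasedLoop Γ v₀}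
    (h : GHomotopic f g) :
    pathSum c f.toFun f.endTime = pathSum c g.toFun g.endTime := by
  rw [gHomotopic_iff] at h
  induction h with
  | refl => rfl
  | @tail f' g' _ h ih =>
    rw [ih]
    have h₁ := f'.endTime_stable.mono (le_max_left f'.endTime g'.endTime)
    have h₂ := g'.endTime_stable.mono (le_max_right f'.endTime g'.endTime)
    rw [hc.pathSum_stable f'.endTime_stable h₁, hc.pathSum_stable g'.endTime_stable h₂,
      ← hc.pathSum_step h, h₁ _ le_rfl, h₂ _ le_rfl, hc.diag, add_zero]

theorem IsCocycle.pathSum_concat {c : V → V → M} (hc : IsCocycle Γ c) (f g : BasedLoop Γ v₀) :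
    pathSum c (f.concat g).toFun (f.concat g).endTime =
      pathSum c f.toFun f.endTime + pathSum c g.toFun g.endTime := by
  rw [hc.pathSum_stable (f.concat g).endTime_stable
    (concatAt_stable f.endTime_stable g.endTime_stable), pathSum, Finset.sum_range_add]
  congr 1
  · refine Finset.sum_congr rfl fun i hi => ?_
    have := Finset.mem_range.1 hi
    simp only [BasedLoop.concat, BasedLoop.concatAt]
    rw [if_pos (by omega), if_pos (by omega)]
  · refine Finset.sum_congr rfl fun i _ => ?_
    simp only [BasedLoop.concat, BasedLoop.concatAt]
    rw [if_neg (show ¬ f.endTime + i + 1 ≤ f.endTime by omega),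
      show f.endTime + i + 1 - f.endTime = i + 1 by omega]
    congr 1
    split_ifs with h
    · obtain rfl : i = 0 := by omega
      rw [g.zero, add_zero, f.endTime_stable _ le_rfl]
    · congr 1; omega

/-- Integration of a cocycle along loops, on homotopy classes. -/
noncomputable def integHom (v₀ : V) {c : V → V → M} (hc : IsCocycle Γ c) :
    A1 Γ v₀ →* Multiplicative M where
  toFun z := Quotient.lift (fun f : BasedLoop Γ v₀ =>
    Multiplicative.ofAdd (pathSum c f.toFun f.endTime))
    (fun _ _ h => congrArg _ (hc.pathSum_homotopic h)) z
  map_one' := by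
    change Multiplicative.ofAdd (pathSum c (BasedLoop.const Γ v₀).toFun _) = _
    rw [hc.pathSum_stable (BasedLoop.const Γ v₀).endTime_stable
      (show Stable _ 0 from fun _ _ => rfl)]
    rfl
  map_mul' a b := by
    induction a using Quotient.ind
    induction b using Quotient.ind
    exact congrArg Multiplicative.ofAdd (hc.pathSum_concat _ _)

/-- Integration of a cocycle along loops. -/
noncomputable def integ (v₀ : V) {c : V → V → M} (hc : IsCocycle Γ c) : A1ab Γ v₀ →ₗ[ℤ] M :=
  (MonoidHom.toAdditiveLeft (Abelianization.lift (integHom v₀ hc))).toIntLinearMap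

theorem integ_abClass {c : V → V → M} (hc : IsCocycle Γ c) (f : BasedLoop Γ v₀) {N : ℕ}
    (hN : Stable f N) : integ v₀ hc f.abClass = pathSum c f.toFun N :=
  -- The integral unfolds to the sum up to `f.endTime`, so only the change of end time needs proof.
  hc.pathSum_stable f.endTime_stable hN

theorem abClass_surj (z : A1ab Γ v₀) : ∃ f : BasedLoop Γ v₀, f.abClass = z := by
  obtain ⟨f, hf⟩ := QuotientGroup.mk_surjective (s := commutator (A1 Γ v₀)) z.toMul
  induction f using Quotient.ind with
  | _ f => exact ⟨f, hf⟩

/-- The sum of `c` along a walk. -/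
def walkSum (c : V → V → M) : {a b : V} → Γ.Walk a b → M
  | _, _, .nil => 0
  | a, _, .cons (v := b) _ p => c a b + walkSum c p

theorem walkSum_append (c : V → V → M) {a b d : V} (p : Γ.Walk a b) (q : Γ.Walk b d) :
    walkSum c (p.append q) = walkSum c p + walkSum c q := by
  induction p with
  | nil => simp [walkSum]
  | cons h p ih => simp [walkSum, ih, add_assoc]

theorem IsCocycle.walkSum_reverse {c : V → V → M} (hc : IsCocycle Γ c) {a b : V}
    (p : Γ.Walk a b) : walkSum c p.reverse = - walkSum c p := by
  induction p with
  | nil => simp [walkSum]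
  | cons h p ih =>
    simp [walkSum, walkSum_append, ih, hc.antisymm (Or.inl h)]

theorem pathSum_getVert (c : V → V → M) {a b : V} (p : Γ.Walk a b) :
    pathSum c p.getVert p.length = walkSum c p := by
  induction p with
  | nil => simp [walkSum, pathSum]
  | cons h p ih =>
    rw [walkSum, ← ih, pathSum, SimpleGraph.Walk.length_cons, Finset.sum_range_succ', add_comm]
    simp [pathSum]

theorem walkSum_congr {c c' : V → V → M} {a b : V} (p : Γ.Walk a b)
    (h : ∀ d ∈ p.darts, c d.fst d.snd = c' d.fst d.snd) : walkSum c p = walkSum c' p := by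
  induction p with
  | nil => rfl
  | cons hadj p ih =>
    simp only [SimpleGraph.Walk.darts_cons, List.mem_cons, forall_eq_or_imp] at h
    rw [walkSum, walkSum, h.1, ih h.2]

theorem walkSum_map {W : Type*} {Δ : SimpleGraph W} (g : Γ →g Δ) (c : W → W → M) {a b : V}
    (p : Γ.Walk a b) : walkSum c (p.map g) = walkSum (fun x y => c (g x) (g y)) p := by
  induction p with
  | nil => rfl
  | cons hadj p ih => simp [walkSum, ih]

theorem walkSum_coboundary (g : V → M) {a b : V} (p : Γ.Walk a b) :
    walkSum (fun x y => g x - g y) p = g a - g b := by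
  induction p with
  | nil => simp [walkSum]
  | cons hadj p ih => rw [walkSum, ih]; abel

theorem walkSum_hom {N : Type*} [AddCommGroup N] (q : M →ₗ[ℤ] N) (c : V → V → M) {a b : V}
    (p : Γ.Walk a b) : q (walkSum c p) = walkSum (fun x y => q (c x y)) p := by
  induction p with
  | nil => simp [walkSum]
  | cons hadj p ih => simp [walkSum, ih]

theorem integ_walk {c : V → V → M} (hc : IsCocycle Γ c) (p : Γ.Walk v₀ v₀) :
    integ v₀ hc (loopOfWalk p).abClass = walkSum c p := by
  rw [integ_abClass hc _ (N := p.length)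
    (fun m hm => SimpleGraph.Walk.getVert_of_length_le _ hm)]
  exact pathSum_getVert c p

theorem integ_cycle {c : V → V → M} (hc : IsCocycle Γ c) {a : V} (P : Γ.Walk v₀ a)
    (C : Γ.Walk a a) :
    integ v₀ hc (loopOfWalk ((P.append C).append P.reverse)).abClass = walkSum c C := by
  rw [integ_walk, walkSum_append, walkSum_append, hc.walkSum_reverse]
  abel

theorem map_integ {N : Type*} [AddCommGroup N] {c : V → V → M} (hc : IsCocycle Γ c)
    (q : M →ₗ[ℤ] N) : q ∘ₗ integ v₀ hc = integ v₀ (hc.map q) := by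
  ext z
  obtain ⟨f, rfl⟩ := abClass_surj z
  rw [LinearMap.comp_apply, integ_abClass hc f f.endTime_stable,
    integ_abClass (hc.map q) f f.endTime_stable]
  exact map_sum q _ _

/-- Cocycles with the same integrals are cohomologous. -/
theorem exists_gauge (hΓ : Γ.Preconnected) {c c' : V → V → M} (hc : IsCocycle Γ c)
    (hc' : IsCocycle Γ c') (h : integ v₀ hc = integ v₀ hc') :
    ∃ g : V → M, ∀ a b, Γ.Adj a b → c a b = g a + c' a b - g b := by
  have P : ∀ a, Γ.Walk v₀ a := fun a => (hΓ v₀ a).some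
  -- The gauge compares the two sums along a chosen path to `a`. Its equation on the edge `a b` is
  -- the equality of integrals over the loop along `P a`, across the edge and back along `P b`.
  refine ⟨fun a => walkSum c' (P a) - walkSum c (P a), fun a b hab => ?_⟩
  have key := LinearMap.congr_fun h
    (loopOfWalk ((P a).append (.cons hab (P b).reverse))).abClass
  rw [integ_walk, integ_walk, walkSum_append, walkSum_append, walkSum, walkSum,
    hc.walkSum_reverse, hc'.walkSum_reverse, ← sub_eq_zero] at key
  rw [← sub_eq_zero, ← key]
  dsimp only
  abel

/-- Cohomologous cocycles have the same integrals. -/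
theorem integ_congr {c c' : V → V → M} (hc : IsCocycle Γ c) (hc' : IsCocycle Γ c') (g : V → M)
    (h : ∀ a b, Γ.Adj a b → c a b = g a + c' a b - g b) : integ v₀ hc = integ v₀ hc' := by
  ext z
  obtain ⟨f, rfl⟩ := abClass_surj z
  rw [integ_abClass hc f f.endTime_stable, integ_abClass hc' f f.endTime_stable]
  have key : ∀ N, pathSum c f.toFun N = g (f.toFun 0) + pathSum c' f.toFun N - g (f.toFun N) := by
    intro N
    induction N with
    | zero => simp [pathSum]
    | succ N ih =>
      have : c (f.toFun N) (f.toFun (N + 1)) =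
          g (f.toFun N) + c' (f.toFun N) (f.toFun (N + 1)) - g (f.toFun (N + 1)) := by
        rcases f.ae N with h1 | h1
        · exact h _ _ h1
        · rw [← h1, hc.diag, hc'.diag]; abel
      rw [pathSum, Finset.sum_range_succ, ← pathSum, ih, this, pathSum, pathSum,
        Finset.sum_range_succ]
      abel
  rw [key, f.zero, f.endTime_stable _ le_rfl]
  abel

end Cocycle

/-! ### Loops given by lists of vertices -/

section Lists

variable {V : Type*} {Γ : SimpleGraph V} {v₀ : V}

/-- The loop with consecutive vertices `v₀, l₀, l₁, …, v₀, v₀, …`. -/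
def listLoop (l : List V) (h : (v₀ :: l ++ [v₀]).IsChain (AE Γ)) : BasedLoop Γ v₀ where
  toFun i := (v₀ :: l).getD i v₀
  isGraphMap := by
    rw [isGraphMap_infPath_iff]
    intro i
    rw [List.isChain_iff_getElem] at h
    have e : ∀ i (hi : i < (v₀ :: l ++ [v₀]).length),
        (v₀ :: l).getD i v₀ = (v₀ :: l ++ [v₀])[i] := by
      intro i hi
      rw [List.getElem_append]
      split_ifs with h'
      · exact List.getD_eq_getElem _ _ h'
      · rw [List.getD_eq_default _ _ (by omega)]; simp
    by_cases hi : i + 1 < (v₀ :: l ++ [v₀]).length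
    · rw [e i (by omega), e (i + 1) hi]
      exact h i hi
    · simp only [List.length_append, List.length_cons, List.length_nil] at hi
      rw [List.getD_eq_default _ _ (by simp; omega), List.getD_eq_default _ _ (by simp; omega)]
      exact AE.rfl' _
  isBased := ⟨rfl, (v₀ :: l).length, fun m hm => List.getD_eq_default _ _ hm⟩

open Classical in
/-- The class of the loop with consecutive vertices `v₀, l₀, l₁, …, v₀`. -/
noncomputable def listClass (Γ : SimpleGraph V) (v₀ : V) (l : List V) : A1ab Γ v₀ :=
  -- The value `0` for a list which is not a loop is a dummy; it lets lists be rewritten without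
  -- carrying proofs.
  if h : (v₀ :: l ++ [v₀]).IsChain (AE Γ) then (listLoop l h).abClass else 0

theorem abClass_congr {f g : BasedLoop Γ v₀} (h : GHomotopic f g) : f.abClass = g.abClass := by
  unfold BasedLoop.abClass
  congr 2
  exact Quotient.sound h

theorem abClass_concat (f g : BasedLoop Γ v₀) :
    (f.concat g).abClass = f.abClass + g.abClass := by
  let F : BasedLoop Γ v₀ → A1 Γ v₀ := fun f => Quotient.mk _ f
  have : F (f.concat g) = F f * F g := rfl
  change Additive.ofMul (Abelianization.of (F (f.concat g))) = _
  rw [this, map_mul]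
  rfl

theorem listClass_append {l l' : List V} (h : (v₀ :: l ++ [v₀]).IsChain (AE Γ))
    (h' : (v₀ :: l' ++ [v₀]).IsChain (AE Γ)) :
    listClass Γ v₀ (l ++ v₀ :: l') = listClass Γ v₀ l + listClass Γ v₀ l' := by
  have h2 : (v₀ :: (l ++ v₀ :: l') ++ [v₀]).IsChain (AE Γ) := by
    have : v₀ :: (l ++ v₀ :: l') ++ [v₀] = (v₀ :: l) ++ v₀ :: (l' ++ [v₀]) := by simp
    rw [this, List.isChain_split]
    exact ⟨h, h'⟩
  rw [listClass, listClass, listClass, dif_pos h, dif_pos h', dif_pos h2, ← abClass_concat]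
  apply abClass_congr
  have hs : Stable (listLoop l h) (l.length + 1) := fun m hm => List.getD_eq_default _ _ hm
  refine GHomotopic.trans' (g := (listLoop l h).concatAt (listLoop l' h') _ hs) ?_
    (concatAt_indep _ _)
  have : listLoop (l ++ v₀ :: l') h2 = (listLoop l h).concatAt (listLoop l' h') _ hs := by
    apply BasedLoop.ext'
    intro i
    simp only [listLoop, BasedLoop.concatAt]
    rw [← List.cons_append]
    split_ifs with hi
    · rcases hi.lt_or_eq with hi | rfl
      · rw [List.getD_append _ _ _ _ (by simpa using hi)]
      · rw [List.getD_append_right _ _ _ _ (by simp),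
          List.getD_eq_default (v₀ :: l) _ (by simp)]
        simp
    · rw [List.getD_append_right _ _ _ _ (by simp; omega)]
      simp
  rw [this]
  exact GHomotopic.rfl' _

theorem listClass_congr {l l' : List V} (h : (v₀ :: l ++ [v₀]).IsChain (AE Γ))
    (h' : (v₀ :: l' ++ [v₀]).IsChain (AE Γ)) (hl : List.Forall₂ (AE Γ) l l') :
    listClass Γ v₀ l = listClass Γ v₀ l' := by
  rw [listClass, listClass, dif_pos h, dif_pos h']
  refine abClass_congr (Step.homotopic fun i => ?_)
  change AE Γ ((v₀ :: l).getD i v₀) ((v₀ :: l').getD i v₀)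
  clear h h'
  have : List.Forall₂ (AE Γ) (v₀ :: l) (v₀ :: l') := .cons (AE.rfl' _) hl
  generalize v₀ :: l = k at *
  generalize v₀ :: l' = k' at *
  induction this generalizing i with
  | nil => exact AE.rfl' _
  | cons h _ ih => cases i with
    | zero => exact h
    | succ i => simpa using ih i

/-- Beyond the end of the list the loop already waits at `v₀`, so both lists define the same
function on `ℕ`. -/
theorem listClass_snoc (l : List V) :
    listClass Γ v₀ (l ++ [v₀]) = listClass Γ v₀ l := by
  unfold listClass
  have : (v₀ :: (l ++ [v₀]) ++ [v₀]).IsChain (AE Γ) ↔ (v₀ :: l ++ [v₀]).IsChain (AE Γ) := by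
    have e : v₀ :: (l ++ [v₀]) ++ [v₀] = (v₀ :: l) ++ v₀ :: [v₀] := by simp
    rw [e, List.isChain_split]
    simp [AE.rfl']
  by_cases h : (v₀ :: l ++ [v₀]).IsChain (AE Γ)
  · rw [dif_pos h, dif_pos (this.2 h)]
    congr 1
    apply BasedLoop.ext'
    intro i
    change (v₀ :: l ++ [v₀]).getD i v₀ = (v₀ :: l).getD i v₀
    by_cases hi : i < (v₀ :: l).length
    · rw [List.getD_append _ _ _ _ hi]
    · rw [List.getD_append_right _ _ _ _ (by omega),
        List.getD_eq_default (v₀ :: l) _ (by omega)]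
      cases i - (v₀ :: l).length <;> simp
  · rw [dif_neg h, dif_neg (mt this.1 h)]

end Lists
-- Reductions of loops and the universal cocycle
section Universal

variable {V : Type*} {Γ : SimpleGraph V} {v₀ : V}

/-- `v₀, l₀, l₁, …, v₀` are the consecutive vertices of a loop. -/
def IsLoopList (Γ : SimpleGraph V) (v₀ : V) (l : List V) : Prop :=
  (v₀ :: l ++ [v₀]).IsChain (AE Γ)

/-- `a, l₀, l₁, …, b` are the consecutive vertices of a path. -/
def IsPathList (Γ : SimpleGraph V) (a : V) (l : List V) (b : V) : Prop :=
  (a :: l ++ [b]).IsChain (AE Γ)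

theorem isPathList_nil {a b : V} : IsPathList Γ a [] b ↔ AE Γ a b := by
  simp [IsPathList]

theorem isPathList_cons {a b d : V} {l : List V} :
    IsPathList Γ a (b :: l) d ↔ AE Γ a b ∧ IsPathList Γ b l d := by
  simp [IsPathList]

theorem isPathList_append {a b d : V} {l l' : List V} :
    IsPathList Γ a (l ++ b :: l') d ↔ IsPathList Γ a l b ∧ IsPathList Γ b l' d := by
  have : a :: (l ++ b :: l') ++ [d] = (a :: l) ++ b :: (l' ++ [d]) := by simp
  rw [IsPathList, this, List.isChain_split]
  rfl

theorem isPathList_reverse {a b : V} {l : List V} :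
    IsPathList Γ a l.reverse b ↔ IsPathList Γ b l a := by
  have : a :: l.reverse ++ [b] = (b :: l ++ [a]).reverse := by simp
  rw [IsPathList, this, List.isChain_reverse]
  have hs : (fun x y => AE Γ y x) = AE Γ := by
    ext x y
    exact ⟨AE.symm, AE.symm⟩
  rw [hs]
  rfl

theorem isLoopList_append {a : V} {l l' : List V} :
    IsLoopList Γ v₀ (l ++ a :: l') ↔ IsPathList Γ v₀ l a ∧ IsPathList Γ a l' v₀ :=
  isPathList_append

theorem forall₂_ae_refl (l : List V) : List.Forall₂ (AE Γ) l l :=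
  List.forall₂_same.2 fun a _ => AE.rfl' a

/-- A pause at `a` can be postponed to the end in one homotopy step: after it, each entry is
replaced by its successor, which is adjacent or equal. A final pause at `v₀` is harmless. -/
theorem listClass_dup {a : V} {l l' : List V} (h : IsLoopList Γ v₀ (l ++ a :: a :: l')) :
    listClass Γ v₀ (l ++ a :: a :: l') = listClass Γ v₀ (l ++ a :: l') := by
  rw [← listClass_snoc (l ++ a :: l')]
  have h' := h
  rw [isLoopList_append, isPathList_cons] at h'
  refine listClass_congr h ?_ ?_
  · change IsLoopList Γ v₀ ((l ++ a :: l') ++ [v₀])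
    rw [isLoopList_append, isPathList_append, isPathList_nil]
    exact ⟨⟨h'.1, h'.2.2⟩, AE.rfl' _⟩
  · rw [List.append_assoc]
    refine List.rel_append (forall₂_ae_refl l) ?_
    refine List.Forall₂.cons (AE.rfl' a) ?_
    have key : ∀ (a : V) (l' : List V), IsPathList Γ a l' v₀ →
        List.Forall₂ (AE Γ) (a :: l') (l' ++ [v₀]) := by
      intro a l'
      induction l' generalizing a with
      | nil => intro h; exact .cons (isPathList_nil.1 h) .nil
      | cons b l' ih =>
        intro h
        rw [isPathList_cons] at h
        exact .cons h.1 (ih b h.2)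
    exact key a l' h'.2.2

theorem listClass_back {a b : V} {l l' : List V} (h : IsLoopList Γ v₀ (l ++ a :: b :: a :: l')) :
    listClass Γ v₀ (l ++ a :: b :: a :: l') = listClass Γ v₀ (l ++ a :: l') := by
  have h' := h
  rw [isLoopList_append, isPathList_cons, isPathList_cons] at h'
  have h1 : IsLoopList Γ v₀ (l ++ a :: a :: l') := by
    rw [isLoopList_append, isPathList_cons]
    exact ⟨h'.1, AE.rfl' _, h'.2.2.2⟩
  have h2 : IsLoopList Γ v₀ (l ++ a :: a :: a :: l') := by
    rw [isLoopList_append, isPathList_cons, isPathList_cons]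
    exact ⟨h'.1, AE.rfl' _, AE.rfl' _, h'.2.2.2⟩
  rw [listClass_congr h h2, listClass_dup h2, listClass_dup h1]
  exact List.rel_append (forall₂_ae_refl l)
    (.cons (AE.rfl' _) (.cons h'.2.2.1 (forall₂_ae_refl _)))

theorem listClass_square {a b b' d : V} {l l' : List V}
    (h : IsLoopList Γ v₀ (l ++ a :: b :: b' :: d :: a :: l')) :
    listClass Γ v₀ (l ++ a :: b :: b' :: d :: a :: l') = listClass Γ v₀ (l ++ a :: l') := by
  have h' := h
  simp only [isLoopList_append, isPathList_cons] at h'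
  obtain ⟨hl, hab, hbb', hb'd, hda, hl'⟩ := h'
  have h1 : IsLoopList Γ v₀ (l ++ a :: d :: a :: l') := by
    simp only [isLoopList_append, isPathList_cons]
    exact ⟨hl, hda.symm, hda, hl'⟩
  have h2 : IsLoopList Γ v₀ (l ++ a :: a :: d :: a :: l') := by
    simp only [isLoopList_append, isPathList_cons]
    exact ⟨hl, AE.rfl' _, hda.symm, hda, hl'⟩
  have h3 : IsLoopList Γ v₀ ((l ++ [a, a]) ++ d :: d :: a :: l') := by
    simp only [List.append_assoc, List.cons_append, List.nil_append]
    simp only [isLoopList_append, isPathList_cons]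
    exact ⟨hl, AE.rfl' _, hda.symm, AE.rfl' _, hda, hl'⟩
  -- The square `a b b' d a` is entrywise close to `a a d d a`, which is a backtrack with pauses.
  rw [← listClass_back h1, ← listClass_dup h2]
  have e := listClass_dup h3
  simp only [List.append_assoc, List.cons_append, List.nil_append] at e h3
  rw [← e]
  refine listClass_congr h h3 (List.rel_append (forall₂_ae_refl l) ?_)
  exact .cons (AE.rfl' _) (.cons hab.symm (.cons hb'd (forall₂_ae_refl _)))

/-- A spur that goes out to the tip `x` and returns the same way is retracted by shortening it at
the tip. -/
theorem listClass_palindrome (l l' : List V) (a x : V) (s : List V)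
    (h : IsLoopList Γ v₀ (l ++ a :: (s.reverse ++ x :: (s ++ a :: l')))) :
    listClass Γ v₀ (l ++ a :: (s.reverse ++ x :: (s ++ a :: l'))) =
      listClass Γ v₀ (l ++ a :: l') := by
  induction s generalizing x with
  | nil => exact listClass_back h
  | cons y s ih =>
    have e : l ++ a :: ((y :: s).reverse ++ x :: (y :: s ++ a :: l')) =
      (l ++ a :: s.reverse) ++ y :: x :: y :: (s ++ a :: l') := by simp
    have e' : l ++ a :: (s.reverse ++ y :: (s ++ a :: l')) =
      (l ++ a :: s.reverse) ++ y :: (s ++ a :: l') := by simp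
    rw [e] at h ⊢
    rw [listClass_back h, ← e', ih y]
    rw [e', isLoopList_append]
    rw [isLoopList_append, isPathList_cons, isPathList_cons] at h
    exact ⟨h.1, h.2.2.2⟩

theorem listClass_nil : listClass Γ v₀ [] = 0 := by
  have h : IsLoopList Γ v₀ [] := isPathList_nil.2 (AE.rfl' _)
  have := listClass_append h h
  rw [List.nil_append, ← List.nil_append [v₀], listClass_snoc] at this
  simpa using this

theorem listClass_path_reverse {a : V} {p : List V} (hp : IsPathList Γ v₀ p a) :
    listClass Γ v₀ (p ++ a :: p.reverse) = 0 := by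
  -- The palindrome lemma needs the root of the spur inside the list, so `v₀` is added at both ends
  -- and removed afterwards.
  have key := listClass_palindrome (v₀ := v₀) (Γ := Γ) [] [] v₀ a p.reverse (by
    rw [List.reverse_reverse, List.nil_append, ← List.singleton_append, ← List.append_assoc]
    change IsLoopList Γ v₀ (([] ++ v₀ :: p) ++ a :: (p.reverse ++ v₀ :: []))
    rw [isLoopList_append, isPathList_append, isPathList_append, isPathList_reverse,
      isPathList_nil]
    exact ⟨⟨AE.rfl' _, hp⟩, hp, AE.rfl' _⟩)
  have hL : IsLoopList Γ v₀ (p ++ a :: p.reverse) := by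
    rw [isLoopList_append, isPathList_reverse]
    exact ⟨hp, hp⟩
  have h0 : IsLoopList Γ v₀ [] := isPathList_nil.2 (AE.rfl' _)
  have e : [] ++ v₀ :: (p.reverse.reverse ++ a :: (p.reverse ++ [v₀])) =
    [] ++ v₀ :: ((p ++ a :: p.reverse) ++ [v₀]) := by simp
  rw [e, listClass_append h0, listClass_snoc, listClass_nil, zero_add, listClass_snoc,
    listClass_nil] at key
  · exact key
  · change IsLoopList Γ v₀ ((p ++ a :: p.reverse) ++ [v₀])
    rw [isLoopList_append, isPathList_nil]
    exact ⟨hL, AE.rfl' _⟩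

theorem exists_isPathList (hΓ : Γ.Preconnected) (a b : V) : ∃ l, IsPathList Γ a l b := by
  obtain ⟨w⟩ := hΓ a b
  induction w with
  | nil => exact ⟨[], isPathList_nil.2 (AE.rfl' _)⟩
  | @cons a b d h p ih =>
    obtain ⟨l, hl⟩ := ih
    exact ⟨b :: l, isPathList_cons.2 ⟨Or.inl h, hl⟩⟩

/-- The concatenation at `b` of two loops passing through it. -/
theorem listClass_join {b : V} {l l' p : List V} (hp : IsPathList Γ v₀ p b)
    (hl : IsPathList Γ v₀ l b) (hl' : IsPathList Γ b l' v₀) :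
    listClass Γ v₀ (l ++ b :: p.reverse) + listClass Γ v₀ (p ++ b :: l') =
      listClass Γ v₀ (l ++ b :: l') := by
  rw [← listClass_append]
  · have e : l ++ b :: p.reverse ++ v₀ :: (p ++ b :: l') =
      l ++ b :: (p.reverse ++ v₀ :: (p ++ b :: l')) := by simp
    rw [e]
    apply listClass_palindrome
    simp only [isLoopList_append, isPathList_append, isPathList_reverse]
    exact ⟨hl, hp, hp, hl'⟩
  · exact isLoopList_append.2 ⟨hl, isPathList_reverse.2 hp⟩
  · exact isLoopList_append.2 ⟨hp, hl'⟩

/-- The universal cocycle with respect to the paths `p a` from the base vertex to `a`. -/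
noncomputable def univ (Γ : SimpleGraph V) (v₀ : V) (p : V → List V) (a b : V) : A1ab Γ v₀ :=
  listClass Γ v₀ (p a ++ a :: b :: (p b).reverse)

variable {p : V → List V} (hp : ∀ a, IsPathList Γ v₀ (p a) a)

include hp

/-- When values on consecutive edges are added, the tails to the common vertex cancel by
`listClass_join`. Around a square there remains a path to `a`, the square, and the path back, which
contracts. -/
theorem univ_isCocycle : IsCocycle Γ (univ Γ v₀ p) where
  diag a := by
    rw [univ, listClass_dup, listClass_path_reverse (hp a)]
    simp only [isLoopList_append, isPathList_cons, isPathList_reverse]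
    exact ⟨hp a, AE.rfl' _, hp a⟩
  square {a b b' d} h1 h2 h3 h4 := by
    have r : ∀ x, IsPathList Γ x (p x).reverse v₀ := fun x => isPathList_reverse.2 (hp x)
    have s1 : univ Γ v₀ p a b + univ Γ v₀ p b b' =
        listClass Γ v₀ (p a ++ a :: b :: b' :: (p b').reverse) := by
      have := listClass_join (l := p a ++ [a]) (l' := b' :: (p b').reverse) (hp b)
        (isPathList_append.2 ⟨hp a, isPathList_nil.2 h1⟩) (isPathList_cons.2 ⟨h2, r b'⟩)
      simpa [univ] using this
    have s2 : listClass Γ v₀ (p a ++ a :: b :: b' :: (p b').reverse) + univ Γ v₀ p b' d =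
        listClass Γ v₀ (p a ++ a :: b :: b' :: d :: (p d).reverse) := by
      have := listClass_join (l := p a ++ [a, b]) (l' := d :: (p d).reverse) (hp b')
        (isPathList_append.2 ⟨hp a, isPathList_cons.2 ⟨h1, isPathList_nil.2 h2⟩⟩)
        (isPathList_cons.2 ⟨h3, r d⟩)
      simpa [univ] using this
    have s3 : listClass Γ v₀ (p a ++ a :: b :: b' :: d :: (p d).reverse) + univ Γ v₀ p d a =
        listClass Γ v₀ (p a ++ a :: b :: b' :: d :: a :: (p a).reverse) := by
      have := listClass_join (l := p a ++ [a, b, b']) (l' := a :: (p a).reverse) (hp d)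
        (isPathList_append.2 ⟨hp a, isPathList_cons.2 ⟨h1, isPathList_cons.2
          ⟨h2, isPathList_nil.2 h3⟩⟩⟩)
        (isPathList_cons.2 ⟨h4, r a⟩)
      simpa [univ] using this
    rw [s1, s2, s3, listClass_square, listClass_path_reverse (hp a)]
    simp only [isLoopList_append, isPathList_cons]
    exact ⟨hp a, h1, h2, h3, h4, r a⟩

/-- The tails cancel as the edges are added one by one. The second claim is carried along because
each cancellation needs a genuine path. -/
theorem pathSum_univ (f : BasedLoop Γ v₀) (N : ℕ) :
    pathSum (univ Γ v₀ p) f.toFun N = listClass Γ v₀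
      (p v₀ ++ (List.range N).map f.toFun ++ f.toFun N :: (p (f.toFun N)).reverse) ∧
    IsPathList Γ v₀ (p v₀ ++ (List.range N).map f.toFun) (f.toFun N) := by
  have r : ∀ x, IsPathList Γ x (p x).reverse v₀ := fun x => isPathList_reverse.2 (hp x)
  induction N with
  | zero => simpa [pathSum, f.zero] using ⟨(listClass_path_reverse (hp v₀)).symm, hp v₀⟩
  | succ N ih =>
    have e : p v₀ ++ (List.range (N + 1)).map f.toFun =
      (p v₀ ++ (List.range N).map f.toFun) ++ [f.toFun N] := by
        simp [List.range_succ]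
    refine ⟨?_, ?_⟩
    · rw [pathSum, Finset.sum_range_succ, ← pathSum, ih.1, univ, listClass_join (hp _) ih.2, e]
      · simp
      · exact isPathList_cons.2 ⟨f.ae N, r _⟩
    · rw [e, isPathList_append, isPathList_nil]
      exact ⟨ih.2, f.ae N⟩

theorem integ_univ : integ v₀ (univ_isCocycle hp) = LinearMap.id := by
  ext z
  obtain ⟨f, rfl⟩ := abClass_surj z
  -- The extra step makes the list of values nonempty, so that its initial `v₀` can be split off.
  have hs : Stable f (f.endTime + 1) := f.endTime_stable.mono (Nat.le_succ _)
  have r : IsPathList Γ v₀ (p v₀).reverse v₀ := isPathList_reverse.2 (hp v₀)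
  rw [integ_abClass _ f hs, (pathSum_univ hp f _).1, hs _ le_rfl]
  obtain ⟨l, hl⟩ : ∃ l, l = (List.range f.endTime).map (fun i => f.toFun (i + 1)) := ⟨_, rfl⟩
  have e : (List.range (f.endTime + 1)).map f.toFun = v₀ :: l := by
    rw [List.range_succ_eq_map, List.map_cons, f.zero, hl, List.map_map]
    rfl
  have hL := (pathSum_univ hp f (f.endTime + 1)).2
  rw [e, hs _ le_rfl, isPathList_append] at hL
  -- The path `p v₀` need not be trivial: it occurs before the loop and reversed after it, and the
  -- two cancel because the group is abelian.
  rw [e, List.append_assoc, List.cons_append, listClass_append hL.1 (isLoopList_append.2 ⟨hL.2, r⟩),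
    listClass_append hL.2 r, add_left_comm, ← listClass_append hL.1 r, listClass_path_reverse (hp v₀), add_zero,
    LinearMap.id_apply]
  have hL2 : (v₀ :: l ++ [v₀]).IsChain (AE Γ) := hL.2
  rw [listClass, dif_pos hL2]
  refine congrArg BasedLoop.abClass (BasedLoop.ext' fun i => ?_)
  change (v₀ :: l).getD i v₀ = _
  rw [← e]
  by_cases hi : i < f.endTime + 1
  · rw [List.getD_eq_getElem _ _ (by simpa using hi)]
    simp
  · rw [List.getD_eq_default _ _ (by simpa using hi), hs _ (by omega)]

end Universal

/-- On a connected graph there is a cocycle with values in `A₁ᴳ(Γ, v₀)ᵃᵇ` whose integral along each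
loop is the class of the loop. -/
theorem exists_univ {V : Type*} {Γ : SimpleGraph V} (hΓ : Γ.Preconnected) (v₀ : V) :
    ∃ (u : V → V → A1ab Γ v₀) (hu : IsCocycle Γ u), integ v₀ hu = LinearMap.id := by
  choose p hp using exists_isPathList hΓ v₀
  exact ⟨_, univ_isCocycle hp, integ_univ hp⟩

/-! ### Inserting and erasing the largest letter -/

section Insertion

variable {m : ℕ}

/-- Insert the largest letter `m` into the word `ρ` at position `l`. -/
def ins (l : Fin (m + 1)) (ρ : Equiv.Perm (Fin m)) : Equiv.Perm (Fin (m + 1)) :=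
  ((finSuccEquiv' l).trans (Equiv.optionCongr ρ)).trans (finSuccEquiv' (Fin.last m)).symm

@[simp] theorem ins_self (l : Fin (m + 1)) (ρ : Equiv.Perm (Fin m)) :
    ins l ρ l = Fin.last m := by
  simp [ins]

@[simp] theorem ins_succAbove (l : Fin (m + 1)) (ρ : Equiv.Perm (Fin m)) (k : Fin m) :
    ins l ρ (l.succAbove k) = (ρ k).castSucc := by
  simp [ins]

theorem eq_ins_iff {l : Fin (m + 1)} {ρ : Equiv.Perm (Fin m)} {σ : Equiv.Perm (Fin (m + 1))} :
    σ = ins l ρ ↔ σ l = Fin.last m ∧ ∀ k, σ (l.succAbove k) = (ρ k).castSucc := by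
  constructor
  · rintro rfl
    simp
  · rintro ⟨h1, h2⟩
    ext i : 1
    rcases Fin.eq_self_or_eq_succAbove l i with rfl | ⟨k, rfl⟩
    · rw [h1, ins_self]
    · rw [h2, ins_succAbove]

@[simp] theorem level_ins (l : Fin (m + 1)) (ρ : Equiv.Perm (Fin m)) : level (ins l ρ) = l := by
  rw [level, Equiv.Perm.inv_eq_iff_eq, ins_self]

theorem exists_eq_ins (σ : Equiv.Perm (Fin (m + 1))) : ∃ ρ, σ = ins (level σ) ρ := by
  refine ⟨Equiv.removeNone (((finSuccEquiv' (level σ)).symm.trans σ).trans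
    (finSuccEquiv' (Fin.last m))), ?_⟩
  have h0 : σ (level σ) = Fin.last m := by simp [level]
  refine eq_ins_iff.2 ⟨h0, fun k => ?_⟩
  set e := ((finSuccEquiv' (level σ)).symm.trans σ).trans (finSuccEquiv' (Fin.last m))
  have hn : e none = none := by simp [e, h0]
  have h2 : some (Equiv.removeNone e k) = e (some k) := by
    apply Equiv.removeNone_some
    rw [← Option.ne_none_iff_exists', ← hn]
    exact fun h => by simpa using e.injective h
  have h3 : e (some k) = finSuccEquiv' (Fin.last m) (σ ((level σ).succAbove k)) := by simp [e]
  rw [h3] at h2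
  have h4 := (Equiv.eq_symm_apply _).2 h2.symm
  rwa [finSuccEquiv'_symm_some, Fin.succAbove_last] at h4

theorem ins_injective (l : Fin (m + 1)) : Function.Injective (ins l) := by
  intro ρ ρ' h
  ext k : 1
  rw [← Fin.castSucc_inj, ← ins_succAbove l, h, ins_succAbove]

/-- Erase the largest letter. -/
noncomputable def erase (σ : Equiv.Perm (Fin (m + 1))) : Equiv.Perm (Fin m) :=
  (exists_eq_ins σ).choose

theorem ins_erase (σ : Equiv.Perm (Fin (m + 1))) : ins (level σ) (erase σ) = σ :=
  (exists_eq_ins σ).choose_spec.symm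

@[simp] theorem erase_ins (l : Fin (m + 1)) (ρ : Equiv.Perm (Fin m)) : erase (ins l ρ) = ρ := by
  apply ins_injective l
  simpa using ins_erase (ins l ρ)

theorem ins_mul_swap (l : Fin (m + 1)) (ρ : Equiv.Perm (Fin m)) (k k' : Fin m) :
    ins l (ρ * Equiv.swap k k') =
      ins l ρ * Equiv.swap (l.succAbove k) (l.succAbove k') := by
  symm
  rw [eq_ins_iff]
  refine ⟨?_, fun p => ?_⟩
  · rw [Equiv.Perm.mul_apply, Equiv.swap_apply_of_ne_of_ne (Fin.succAbove_ne _ _).symm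
      (Fin.succAbove_ne _ _).symm, ins_self]
  · rw [Equiv.Perm.mul_apply, Equiv.Perm.mul_apply,
      Function.Injective.swap_apply Fin.succAbove_right_injective, ins_succAbove]

theorem ins_succ_eq (k : Fin m) (ρ : Equiv.Perm (Fin m)) :
    ins k.succ ρ = ins k.castSucc ρ * Equiv.swap k.castSucc k.succ := by
  symm
  rw [eq_ins_iff]
  refine ⟨by simp, fun p => ?_⟩
  rw [Equiv.Perm.mul_apply, ← ins_succAbove k.castSucc]
  congr 1
  rw [Equiv.swap_apply_def]
  simp only [Fin.succAbove, Fin.ext_iff, Fin.lt_def]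
  split_ifs <;> simp_all <;> omega

theorem ins_castSucc_eq (k : Fin m) (ρ : Equiv.Perm (Fin m)) :
    ins k.castSucc ρ = ins k.succ ρ * Equiv.swap k.castSucc k.succ := by
  rw [ins_succ_eq, mul_assoc, Equiv.swap_mul_self, mul_one]

theorem adj_ins_succ (k : Fin m) (ρ : Equiv.Perm (Fin m)) :
    (boolGraph (m + 1)).Adj (ins k.castSucc ρ) (ins k.succ ρ) :=
  ⟨k.castSucc, k.succ, by simp, ins_succ_eq k ρ⟩

theorem succAbove_of_lt {l : Fin (m + 1)} {k : Fin m} (h : k.val < l.val) :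
    (l.succAbove k).val = k.val := by
  rw [Fin.succAbove_of_castSucc_lt _ _ h]; rfl

theorem succAbove_of_ge {l : Fin (m + 1)} {k : Fin m} (h : l.val ≤ k.val) :
    (l.succAbove k).val = k.val + 1 := by
  rw [Fin.succAbove_of_le_castSucc _ _ h]; rfl

/-- The letters at positions `k` and `k + 1` stay neighbours unless the largest letter is inserted
exactly between them, at position `k + 1`. -/
theorem adj_ins_swap {l : Fin (m + 1)} {k k' : Fin m} (hk : k.val + 1 = k'.val)
    (hl : l.val ≠ k'.val) (ρ : Equiv.Perm (Fin m)) :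
    (boolGraph (m + 1)).Adj (ins l ρ) (ins l (ρ * Equiv.swap k k')) := by
  refine ⟨l.succAbove k, l.succAbove k', ?_, ins_mul_swap l ρ k k'⟩
  rcases lt_or_gt_of_ne hl with h | h
  · rw [succAbove_of_ge (by omega), succAbove_of_ge (by omega), hk]
  · rw [succAbove_of_lt (by omega), succAbove_of_lt (by omega), hk]

/-- Two adjacent vertices differ by a move of the largest letter or by a swap of two others. -/
theorem adj_cases {σ τ : Equiv.Perm (Fin (m + 1))} (h : (boolGraph (m + 1)).Adj σ τ) :
    (∃ (k : Fin m) (ρ : Equiv.Perm (Fin m)), σ = ins k.castSucc ρ ∧ τ = ins k.succ ρ) ∨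
    (∃ (k : Fin m) (ρ : Equiv.Perm (Fin m)), σ = ins k.succ ρ ∧ τ = ins k.castSucc ρ) ∨
    (∃ (l : Fin (m + 1)) (k k' : Fin m) (ρ : Equiv.Perm (Fin m)), k.val + 1 = k'.val ∧
      l.val ≠ k'.val ∧ σ = ins l ρ ∧ τ = ins l (ρ * Equiv.swap k k')) := by
  obtain ⟨i, j, hij, rfl⟩ := h
  obtain ⟨ρ, hρ⟩ := exists_eq_ins σ
  generalize level σ = l at hρ
  subst hρ
  have hi : i.val < m := by omega
  have ei : i = (⟨i.val, hi⟩ : Fin m).castSucc := rfl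
  have ej : j = (⟨i.val, hi⟩ : Fin m).succ := Fin.ext (by simp [hij])
  by_cases h1 : l = i
  · left
    refine ⟨⟨i.val, hi⟩, ρ, by rw [h1]; rfl, ?_⟩
    rw [h1, ins_succ_eq, ← ei, ← ej]
  by_cases h2 : l = j
  · right; left
    refine ⟨⟨i.val, hi⟩, ρ, by rw [← ej, h2], ?_⟩
    rw [h2, ins_castSucc_eq, ← ei, ← ej]
  right; right
  obtain ⟨k, rfl⟩ := Fin.exists_succAbove_eq (Ne.symm h1)
  obtain ⟨k', rfl⟩ := Fin.exists_succAbove_eq (Ne.symm h2)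
  refine ⟨l, k, k', ρ, ?_, ?_, rfl, (ins_mul_swap l ρ k k').symm⟩
  all_goals
    rcases lt_or_ge k.val l.val with h3 | h3 <;> rcases lt_or_ge k'.val l.val with h4 | h4 <;>
      simp only [succAbove_of_lt, succAbove_of_ge, h3, h4] at hij <;> omega

/-- Edges are right multiplications by simple transpositions, which generate the symmetric group as
a monoid. -/
theorem boolGraph_preconnected (n : ℕ) : (boolGraph n).Preconnected := by
  cases n with
  | zero => intro σ τ; rw [Subsingleton.elim σ τ]
  | succ n =>
    have key : ∀ g ∈ Submonoid.closure (Set.range fun i : Fin n => Equiv.swap i.castSucc i.succ),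
        ∀ σ : Equiv.Perm (Fin (n + 1)), (boolGraph (n + 1)).Reachable σ (σ * g) := by
      intro g hg
      induction hg using Submonoid.closure_induction with
      | mem g hg =>
        obtain ⟨i, rfl⟩ := hg
        exact fun σ => SimpleGraph.Adj.reachable ⟨i.castSucc, i.succ, by simp, rfl⟩
      | one => intro σ; rw [mul_one]
      | mul g g' _ _ h h' =>
        intro σ
        rw [← mul_assoc]
        exact (h σ).trans (h' _)
    intro σ τ
    have := key (σ⁻¹ * τ) (by rw [Equiv.Perm.mclosure_swap_castSucc_succ]; trivial) σ
    rwa [mul_inv_cancel_left] at this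

/-- Edges moving the largest letter collapse to a vertex; all others exchange letters which are
still neighbours after the erasure. -/
theorem erase_ae {σ τ : Equiv.Perm (Fin (m + 1))} (h : AE (boolGraph (m + 1)) σ τ) :
    AE (boolGraph m) (erase σ) (erase τ) := by
  rcases h with h | rfl
  · rcases adj_cases h with ⟨k, ρ, rfl, rfl⟩ | ⟨k, ρ, rfl, rfl⟩ | ⟨l, k, k', ρ, hk, -, rfl, rfl⟩
    · simp [AE.rfl']
    · simp [AE.rfl']
    · rw [erase_ins, erase_ins]
      exact Or.inl ⟨k, k', hk, rfl⟩
  · exact AE.rfl' _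

/-- The inclusion of `Γ(B_m)` as the top level of `Γ(B_{m+1})`. -/
def insLast (m : ℕ) : boolGraph m →g boolGraph (m + 1) where
  toFun := ins (Fin.last m)
  map_rel' := by
    rintro σ τ ⟨k, k', hk, rfl⟩
    exact adj_ins_swap hk (by simp; omega) _

theorem insLast_ae {ρ τ : Equiv.Perm (Fin m)} (h : AE (boolGraph m) ρ τ) :
    AE (boolGraph (m + 1)) (insLast m ρ) (insLast m τ) :=
  h.imp (insLast m).map_adj (congrArg _)

end Insertion

/-! ### The standard vertical hexagons -/

section Hexagon

variable {m : ℕ}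

theorem swap_ne {k k' : Fin m} (hk : k.val + 1 = k'.val) (ρ : Equiv.Perm (Fin m)) :
    ρ ≠ ρ * Equiv.swap k k' := by
  intro h
  have h1 : Equiv.swap k k' = 1 := by simpa using h.symm
  rw [Equiv.swap_eq_one_iff] at h1
  subst h1
  omega

theorem ins_ne_of_val_ne {l l' : Fin (m + 1)} (h : l.val ≠ l'.val) (ρ ρ' : Equiv.Perm (Fin m)) :
    ins l ρ ≠ ins l' ρ' := fun e => h (by rw [← level_ins l ρ, e, level_ins])

/-- This and the next three identities give the labels of the hexagon. With the largest letter at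
position `k + 2` the other two occupy `k, k + 1`; with it at `k` they occupy `k + 1, k + 2`. So the
two labels alternate. -/
theorem ins_top_eq {k k' : Fin m} (hk : k.val + 1 = k'.val) (ρ : Equiv.Perm (Fin m)) :
    ins k'.succ ρ = ins k.succ ρ * Equiv.swap k.succ k'.succ := by
  have e : k.succ = k'.castSucc := Fin.ext (by simp [hk])
  rw [e]; exact ins_succ_eq k' ρ

theorem ins_mid_eq {k k' : Fin m} (hk : k.val + 1 = k'.val) (ρ : Equiv.Perm (Fin m)) :
    ins k.succ ρ = ins k'.succ ρ * Equiv.swap k.succ k'.succ := by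
  rw [ins_top_eq hk, mul_assoc, Equiv.swap_mul_self, mul_one]

theorem ins_top_swap {k k' : Fin m} (hk : k.val + 1 = k'.val) (ρ : Equiv.Perm (Fin m)) :
    ins k'.succ (ρ * Equiv.swap k k') = ins k'.succ ρ * Equiv.swap k.castSucc k.succ := by
  rw [ins_mul_swap]
  congr 2
  · exact Fin.ext (succAbove_of_lt (by simp; omega))
  · exact Fin.ext ((succAbove_of_lt (by simp)).trans (by simp [hk]))

theorem ins_bot_swap {k k' : Fin m} (hk : k.val + 1 = k'.val) (ρ : Equiv.Perm (Fin m)) :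
    ins k.castSucc (ρ * Equiv.swap k k') = ins k.castSucc ρ * Equiv.swap k.succ k'.succ := by
  rw [ins_mul_swap]
  congr 2
  · exact Fin.ext (succAbove_of_ge (by simp))
  · exact Fin.ext (succAbove_of_ge (by simp; omega))

/-- The vertical hexagon in which the largest letter passes over the two letters at the positions
`k` and `k' = k + 1` of `ρ`. -/
def vertHex {k k' : Fin m} (hk : k.val + 1 = k'.val) (ρ : Equiv.Perm (Fin m)) :
    (boolGraph (m + 1)).Walk (ins k.castSucc ρ) (ins k.castSucc ρ) :=
  have e : k.succ = k'.castSucc := Fin.ext (by simp [hk])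
  have h (ρ : Equiv.Perm (Fin m)) : (boolGraph (m + 1)).Adj (ins k.succ ρ) (ins k'.succ ρ) :=
    e ▸ adj_ins_succ k' ρ
  .cons (adj_ins_succ k ρ) <| .cons (h ρ) <|
  .cons (adj_ins_swap hk (by simp) ρ) <| .cons (h _).symm <| .cons (adj_ins_succ k _).symm <|
  .cons (adj_ins_swap (l := k.castSucc) hk (by simp; omega) ρ).symm .nil

theorem vertHex_isVertical {k k' : Fin m} (hk : k.val + 1 = k'.val) (ρ : Equiv.Perm (Fin m)) :
    IsVertical (vertHex hk ρ) := by
  have hne := swap_ne hk ρ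
  have hi (l : Fin (m + 1)) : ins l ρ ≠ ins l (ρ * Equiv.swap k k') :=
    fun h => hne (ins_injective l h)
  have h01 := ins_ne_of_val_ne (l := k.castSucc) (l' := k.succ) (by simp)
  have h02 := ins_ne_of_val_ne (l := k.castSucc) (l' := k'.succ) (by simp; omega)
  have h12 := ins_ne_of_val_ne (l := k.succ) (l' := k'.succ) (by simp; omega)
  refine ⟨⟨?_, rfl, k.castSucc, k.succ, k'.succ, by simp, by simp [hk], ?_⟩, k.val, ?_⟩
  · rw [vertHex, SimpleGraph.Walk.cons_isCycle_iff]
    constructor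
    · apply SimpleGraph.Walk.IsPath.mk'
      simp [hi, h12, fun ρ ρ' => (h01 ρ ρ').symm, fun ρ ρ' => (h02 ρ ρ').symm,
        fun ρ ρ' => (h12 ρ ρ').symm, (hi _).symm]
    · simp [hi, h01, h02, h12, fun ρ ρ' => (h01 ρ ρ').symm]
  · simp only [vertHex, SimpleGraph.Walk.darts_cons, SimpleGraph.Walk.darts_nil, List.mem_cons,
      List.not_mem_nil, or_false, forall_eq_or_imp, forall_eq]
    refine ⟨Or.inl (ins_succ_eq _ _), Or.inr (ins_top_eq hk _), Or.inl (ins_top_swap hk _),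
      Or.inr (ins_mid_eq hk _), Or.inl (ins_castSucc_eq _ _), Or.inr ?_⟩
    rw [← ins_bot_swap hk, mul_assoc, Equiv.swap_mul_self, mul_one]
  · have key (l : Fin (m + 1)) (hl : l = k.castSucc ∨ l = k.succ ∨ l = k'.succ) :
        {v | v ∈ (vertHex hk ρ).support ∧ (level v).val = l.val} =
          {ins l ρ, ins l (ρ * Equiv.swap k k')} := by
      ext v
      simp only [vertHex, SimpleGraph.Walk.support_cons, SimpleGraph.Walk.support_nil,
        List.mem_cons, List.not_mem_nil, or_false, Set.mem_ofPred_eq, Set.mem_insert_iff,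
        Set.mem_singleton_iff]
      constructor
      · rintro ⟨h, hv⟩
        obtain rfl : level v = l := Fin.ext hv
        rcases h with h | h | h | h | h | h | h <;> rw [h] <;> simp
      · rintro (rfl | rfl)
        · rcases hl with rfl | rfl | rfl <;> simp
        · rcases hl with rfl | rfl | rfl <;> simp
    rintro _ (rfl | rfl | rfl)
    · rw [show k.val = k.castSucc.val from rfl, key _ (by simp), Set.ncard_pair (hi _)]
    · rw [show k.val + 1 = k.succ.val by simp, key _ (by simp), Set.ncard_pair (hi _)]
    · rw [show k.val + 2 = k'.succ.val by simp; omega, key _ (by simp), Set.ncard_pair (hi _)]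

end Hexagon
-- Erasing vertical hexagons and pushing edges to the top level
section Pushing

variable {m : ℕ} {M : Type*} [AddCommGroup M]

theorem forall_support_of_labels {n : ℕ} {s t : Equiv.Perm (Fin n)}
    {I : Equiv.Perm (Fin n) → Prop} (hs : ∀ v, I v → I (v * s)) (ht : ∀ v, I v → I (v * t))
    {σ τ : Equiv.Perm (Fin n)} (p : (boolGraph n).Walk σ τ)
    (hp : ∀ d ∈ p.darts, d.snd = d.fst * s ∨ d.snd = d.fst * t) (h : I σ) :
    ∀ v ∈ p.support, I v := by
  induction p with
  | nil => simpa using h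
  | cons hadj p ih =>
    simp only [SimpleGraph.Walk.darts_cons, List.mem_cons, forall_eq_or_imp] at hp
    simp only [SimpleGraph.Walk.support_cons, List.mem_cons, forall_eq_or_imp]
    refine ⟨h, ih hp.2 ?_⟩
    rcases hp.1 with h1 | h1
    · exact h1 ▸ hs _ h
    · exact h1 ▸ ht _ h

theorem level_mul_swap (σ : Equiv.Perm (Fin (m + 1))) (i j : Fin (m + 1)) :
    level (σ * Equiv.swap i j) = Equiv.swap i j (level σ) := by
  simp [level, mul_inv_rev]

/-- Erasing the largest letter maps the vertices of a vertical hexagon to the ends of an edge. -/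
theorem walkSum_erase_of_isVertical {c : Equiv.Perm (Fin m) → Equiv.Perm (Fin m) → M}
    (hc : IsCocycle (boolGraph m) c) {σ : Equiv.Perm (Fin (m + 1))}
    {C : (boolGraph (m + 1)).Walk σ σ} (hC : IsVertical C) :
    walkSum (fun a b => c (erase a) (erase b)) C = 0 := by
  obtain ⟨⟨-, -, i, j, d, hij, hjd, hd⟩, l, hl⟩ := hC
  -- If the largest letter is at none of the three positions moved by the labels, the level is
  -- constant along the cycle, so the cycle is not vertical.
  by_cases hσ : level σ = i ∨ level σ = j ∨ level σ = d
  · obtain ⟨k, k', hk, rfl, rfl, rfl⟩ : ∃ k k' : Fin m, k.val + 1 = k'.val ∧ i = k.castSucc ∧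
        j = k.succ ∧ d = k'.succ :=
      ⟨⟨i.val, by omega⟩, ⟨j.val, by omega⟩, hij, rfl, Fin.ext (by simp [hij]),
        Fin.ext (by simp [hjd])⟩
    obtain ⟨ρ, hρ⟩ : ∃ ρ, ρ = erase σ := ⟨_, rfl⟩
    have hss : ρ * Equiv.swap k k' * Equiv.swap k k' = ρ := by
      rw [mul_assoc, Equiv.swap_mul_self, mul_one]
    -- Three positions of the largest letter and two orders of the other letters: these six
    -- permutations are closed under both labels.
    let I (v : Equiv.Perm (Fin (m + 1))) : Prop :=
      ∃ l τ, v = ins l τ ∧ (l = k.castSucc ∨ l = k.succ ∨ l = k'.succ) ∧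
        (τ = ρ ∨ τ = ρ * Equiv.swap k k')
    have hs : ∀ v, I v → I (v * Equiv.swap k.castSucc k.succ) := by
      rintro _ ⟨l, τ, rfl, rfl | rfl | rfl, hτ⟩
      · exact ⟨k.succ, τ, (ins_succ_eq _ _).symm, by simp, hτ⟩
      · exact ⟨k.castSucc, τ, (ins_castSucc_eq _ _).symm, by simp, hτ⟩
      · refine ⟨k'.succ, τ * Equiv.swap k k', (ins_top_swap hk τ).symm, by simp, ?_⟩
        rcases hτ with rfl | rfl
        · exact Or.inr rfl
        · exact Or.inl hss
    have ht : ∀ v, I v → I (v * Equiv.swap k.succ k'.succ) := by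
      rintro _ ⟨l, τ, rfl, rfl | rfl | rfl, hτ⟩
      · refine ⟨k.castSucc, τ * Equiv.swap k k', (ins_bot_swap hk τ).symm, by simp, ?_⟩
        rcases hτ with rfl | rfl
        · exact Or.inr rfl
        · exact Or.inl hss
      · exact ⟨k'.succ, τ, (ins_top_eq hk _).symm, by simp, hτ⟩
      · exact ⟨k.succ, τ, (ins_mid_eq hk _).symm, by simp, hτ⟩
    have key := forall_support_of_labels hs ht C hd
      ⟨level σ, erase σ, (ins_erase σ).symm, hσ, Or.inl hρ.symm⟩
    have key' : ∀ v ∈ C.support, erase v = ρ ∨ erase v = ρ * Equiv.swap k k' := by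
      intro v hv
      obtain ⟨l, τ, rfl, -, h⟩ := key v hv
      rwa [erase_ins]
    have hne := swap_ne hk ρ
    have hadj : AE (boolGraph m) ρ (ρ * Equiv.swap k k') := Or.inl ⟨k, k', hk, rfl⟩
    classical
    -- On the single edge which contains the image, `c` is the coboundary of `g`, so the closed sum
    -- telescopes.
    let g (v : Equiv.Perm (Fin (m + 1))) : M := if erase v = ρ then c ρ (ρ * Equiv.swap k k') else 0
    rw [walkSum_congr (c' := fun a b => g a - g b), walkSum_coboundary, sub_self]
    intro x hx
    rcases key' _ (C.dart_fst_mem_support_of_mem_darts hx) with h1 | h1 <;>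
      rcases key' _ (C.dart_snd_mem_support_of_mem_darts hx) with h2 | h2 <;>
      simp [g, h1, h2, hc.diag, hne.symm, hc.antisymm hadj]
  · exfalso
    push Not at hσ
    have key := forall_support_of_labels (I := fun v => level v = level σ)
      (fun v hv => by rw [level_mul_swap, hv, Equiv.swap_apply_of_ne_of_ne hσ.1 hσ.2.1])
      (fun v hv => by rw [level_mul_swap, hv, Equiv.swap_apply_of_ne_of_ne hσ.2.1 hσ.2.2])
      C hd rfl
    have h1 := hl l (by simp)
    have h2 := hl (l + 1) (by simp)
    obtain ⟨v, hv, hv'⟩ := Set.nonempty_of_ncard_ne_zero (by rw [h1]; decide)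
    obtain ⟨w, hw, hw'⟩ := Set.nonempty_of_ncard_ne_zero (by rw [h2]; decide)
    rw [key v hv] at hv'
    rw [key w hw] at hw'
    omega

variable {w : Equiv.Perm (Fin (m + 1)) → Equiv.Perm (Fin (m + 1)) → M}

/-- The sum of `w` along the path which moves the largest letter from position `l` to the end. -/
def pushSum (w : Equiv.Perm (Fin (m + 1)) → Equiv.Perm (Fin (m + 1)) → M) (l : ℕ)
    (ρ : Equiv.Perm (Fin m)) : M :=
  ∑ k : Fin m, if l ≤ k.val then w (ins k.castSucc ρ) (ins k.succ ρ) else 0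

theorem pushSum_castSucc (k : Fin m) (ρ : Equiv.Perm (Fin m)) :
    pushSum w k.val ρ = w (ins k.castSucc ρ) (ins k.succ ρ) + pushSum w (k.val + 1) ρ := by
  rw [pushSum, pushSum, ← Finset.add_sum_erase _ _ (Finset.mem_univ k), if_pos le_rfl,
    ← Finset.add_sum_erase (a := k) _ (fun i : Fin m =>
      if k.val + 1 ≤ i.val then w (ins i.castSucc ρ) (ins i.succ ρ) else 0) (Finset.mem_univ k)]
  simp only [Nat.succ_le_iff, lt_self_iff_false, if_false, zero_add]
  congr 1
  refine Finset.sum_congr rfl fun i hi => ?_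
  have : i.val ≠ k.val := fun h => (Finset.ne_of_mem_erase hi) (Fin.ext h)
  simp only [show k.val ≤ i.val ↔ k.val < i.val by omega]

theorem pushSum_last (ρ : Equiv.Perm (Fin m)) : pushSum w m ρ = 0 :=
  Finset.sum_eq_zero fun k _ => if_neg (by omega)

/-- If `w` vanishes on vertical hexagons, edges can be pushed to the top level. -/
theorem push_swap (hw : IsCocycle (boolGraph (m + 1)) w)
    (hex : ∀ {k k' : Fin m} (hk : k.val + 1 = k'.val) (ρ), walkSum w (vertHex hk ρ) = 0)
    {k k' : Fin m} (hk : k.val + 1 = k'.val) (ρ : Equiv.Perm (Fin m)) :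
    ∀ (d : ℕ) (l : Fin (m + 1)), l.val + d = m → l.val ≠ k'.val →
      w (ins l ρ) (ins l (ρ * Equiv.swap k k')) =
        pushSum w l.val ρ + w (ins (Fin.last m) ρ) (ins (Fin.last m) (ρ * Equiv.swap k k')) -
          pushSum w l.val (ρ * Equiv.swap k k') := by
  intro d
  induction d using Nat.strong_induction_on with
  | _ d ih =>
    intro l hld hl
    obtain ⟨ρ', hρ'⟩ : ∃ ρ', ρ' = ρ * Equiv.swap k k' := ⟨_, rfl⟩
    have hadj (l : Fin (m + 1)) (hl : l.val ≠ k'.val) :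
        AE (boolGraph (m + 1)) (ins l ρ) (ins l ρ') := by
      rw [hρ']; exact Or.inl (adj_ins_swap hk hl ρ)
    simp only [← hρ'] at ih ⊢
    rcases Fin.eq_castSucc_or_eq_last l with ⟨i, rfl⟩ | rfl
    -- Induction on the distance `d` to the top level. From `l = k` the edge cannot be raised by one
    -- level, where the largest letter would separate the two letters; the vertical hexagon raises
    -- it by two.
    · by_cases hik : i = k
      · subst hik
        have h1 := ih (d - 2) (by have := k'.isLt; simp at hld; omega) k'.succ
          (by have := k'.isLt; simp at hld ⊢; omega) (by simp)
        have hv := hex hk ρ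
        simp only [vertHex, walkSum, add_zero] at hv
        rw [← hρ'] at hv
        have e : i.succ = k'.castSucc := Fin.ext (by simp [hk])
        have ha (ρ : Equiv.Perm (Fin m)) := hw.antisymm (Or.inl (adj_ins_succ i ρ))
        have hb (ρ : Equiv.Perm (Fin m)) := hw.antisymm (Or.inl (adj_ins_succ k' ρ))
        have hp (ρ : Equiv.Perm (Fin m)) : pushSum w i.val ρ =
            w (ins i.castSucc ρ) (ins i.succ ρ) + (w (ins i.succ ρ) (ins k'.succ ρ) +
              pushSum w k'.succ.val ρ) := by
          rw [pushSum_castSucc, hk, pushSum_castSucc, e, Fin.val_succ]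
        rw [← e] at hb
        rw [hw.antisymm (hadj i.castSucc (by simp; omega)), ha, hb, h1] at hv
        rw [Fin.val_castSucc, hp, hp, ← sub_eq_zero, ← neg_eq_zero, ← hv]
        abel
      -- Otherwise the move of the largest letter and the swap form a square, which raises the edge
      -- by one level.
      · have hik' : i.val ≠ k.val := fun h => hik (Fin.ext h)
        have hne : i.succ.val ≠ k'.val := by simp; omega
        have h1 := ih (d - 1) (by have := i.isLt; simp at hld; omega) i.succ
          (by have := i.isLt; simp at hld ⊢; omega) hne
        have hsq := hw.square (Or.inl (adj_ins_succ i ρ)) (hadj _ hne)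
          (Or.inl (adj_ins_succ i ρ').symm) (hadj _ hl).symm
        rw [hw.antisymm (Or.inl (adj_ins_succ i ρ')), hw.antisymm (hadj _ hl), h1] at hsq
        rw [Fin.val_castSucc, pushSum_castSucc, pushSum_castSucc, ← sub_eq_zero, ← neg_eq_zero,
          ← hsq, Fin.val_succ]
        abel
    · simp [pushSum_last]

/-- If `w` vanishes on vertical hexagons, then it is cohomologous to its restriction to the top
level, pulled back by erasing the largest letter. -/
theorem push_adj (hw : IsCocycle (boolGraph (m + 1)) w)
    (hex : ∀ {k k' : Fin m} (hk : k.val + 1 = k'.val) (ρ), walkSum w (vertHex hk ρ) = 0)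
    {σ τ : Equiv.Perm (Fin (m + 1))} (h : (boolGraph (m + 1)).Adj σ τ) :
    w σ τ = pushSum w (level σ).val (erase σ) + w (insLast m (erase σ)) (insLast m (erase τ)) -
      pushSum w (level τ).val (erase τ) := by
  rcases adj_cases h with ⟨k, ρ, rfl, rfl⟩ | ⟨k, ρ, rfl, rfl⟩ | ⟨l, k, k', ρ, hk, hl, rfl, rfl⟩
  · simp [pushSum_castSucc, hw.diag]
  · simp [pushSum_castSucc, hw.diag, hw.antisymm (Or.inl (adj_ins_succ k ρ))]
  · simp only [level_ins, erase_ins]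
    exact push_swap hw hex hk ρ (m - l.val) l (by omega) hl

end Pushing

/-! ### Splitting off the vertical classes -/

section Decomposition

/-- The universal cocycle on `Γ(B_n)`. -/
noncomputable def boolUniv {n : ℕ} (σ₀ : Equiv.Perm (Fin n)) :
    Equiv.Perm (Fin n) → Equiv.Perm (Fin n) → A1ab (boolGraph n) σ₀ :=
  (exists_univ (boolGraph_preconnected n) σ₀).choose

theorem boolUniv_isCocycle {n : ℕ} (σ₀ : Equiv.Perm (Fin n)) :
    IsCocycle (boolGraph n) (boolUniv σ₀) :=
  (exists_univ (boolGraph_preconnected n) σ₀).choose_spec.choose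

theorem integ_boolUniv {n : ℕ} (σ₀ : Equiv.Perm (Fin n)) :
    integ σ₀ (boolUniv_isCocycle σ₀) = LinearMap.id :=
  (exists_univ (boolGraph_preconnected n) σ₀).choose_spec.choose_spec

/-- Integrating the universal cocycle is the identity, and the contributions of `P` and its reverse
cancel. In particular the class does not depend on `P`. -/
theorem cycle_class_eq {n : ℕ} {σ₀ σ : Equiv.Perm (Fin n)} (P : (boolGraph n).Walk σ₀ σ)
    (C : (boolGraph n).Walk σ σ) :
    (loopOfWalk ((P.append C).append P.reverse)).abClass = walkSum (boolUniv σ₀) C := by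
  rw [← integ_cycle (boolUniv_isCocycle σ₀) P C, integ_boolUniv, LinearMap.id_apply]

theorem mem_cycleClasses_iff {n : ℕ} {σ₀ : Equiv.Perm (Fin n)}
    {Q : ∀ σ : Equiv.Perm (Fin n), (boolGraph n).Walk σ σ → Prop} {x : A1ab (boolGraph n) σ₀} :
    x ∈ cycleClasses σ₀ Q ↔ ∃ (σ : Equiv.Perm (Fin n)) (C : (boolGraph n).Walk σ σ), Q σ C ∧
      x = walkSum (boolUniv σ₀) C := by
  constructor
  · rintro ⟨σ, P, C, hC, rfl⟩
    exact ⟨σ, C, hC, cycle_class_eq P C⟩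
  · rintro ⟨σ, C, hC, rfl⟩
    let P := (boolGraph_preconnected n σ₀ σ).some
    exact ⟨σ, P, C, hC, (cycle_class_eq P C).symm⟩

theorem integ_walkSum_boolUniv {n : ℕ} {σ₀ σ : Equiv.Perm (Fin n)} {M : Type*} [AddCommGroup M]
    {c : Equiv.Perm (Fin n) → Equiv.Perm (Fin n) → M} (hc : IsCocycle (boolGraph n) c)
    (C : (boolGraph n).Walk σ σ) : integ σ₀ hc (walkSum (boolUniv σ₀) C) = walkSum c C := by
  rw [← cycle_class_eq (boolGraph_preconnected n σ₀ σ).some C, integ_cycle]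

variable {m : ℕ} (σ₀ : Equiv.Perm (Fin (m + 1))) (ρ₀ : Equiv.Perm (Fin m))

/-- The map induced by erasing the largest letter. -/
noncomputable def retr : A1ab (boolGraph (m + 1)) σ₀ →ₗ[ℤ] A1ab (boolGraph m) ρ₀ :=
  integ σ₀ ((boolUniv_isCocycle ρ₀).comp erase_ae)

/-- The map induced by the inclusion of the top level. -/
noncomputable def incl : A1ab (boolGraph m) ρ₀ →ₗ[ℤ] A1ab (boolGraph (m + 1)) σ₀ :=
  integ ρ₀ ((boolUniv_isCocycle σ₀).comp insLast_ae)

theorem retr_walkSum {σ : Equiv.Perm (Fin (m + 1))} (C : (boolGraph (m + 1)).Walk σ σ) :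
    retr σ₀ ρ₀ (walkSum (boolUniv σ₀) C) =
      walkSum (fun a b => boolUniv ρ₀ (erase a) (erase b)) C :=
  integ_walkSum_boolUniv _ C

theorem incl_walkSum {ρ : Equiv.Perm (Fin m)} (C : (boolGraph m).Walk ρ ρ) :
    incl σ₀ ρ₀ (walkSum (boolUniv ρ₀) C) = walkSum (boolUniv σ₀) (C.map (insLast m)) := by
  rw [walkSum_map]
  exact integ_walkSum_boolUniv _ C

/-- Pulling back a linear image of the universal cocycle. -/
theorem integ_map_comp {n k : ℕ} {N : Type*} [AddCommGroup N] (α₀ : Equiv.Perm (Fin n))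
    (β₀ : Equiv.Perm (Fin k)) {c : Equiv.Perm (Fin n) → Equiv.Perm (Fin n) → N}
    (hc : IsCocycle (boolGraph n) c)
    {g : Equiv.Perm (Fin k) → Equiv.Perm (Fin n)}
    (hg : ∀ {a b}, AE (boolGraph k) a b → AE (boolGraph n) (g a) (g b)) :
    integ α₀ hc ∘ₗ integ β₀ ((boolUniv_isCocycle α₀).comp hg) = integ β₀ (hc.comp hg) := by
  -- By universality `c` is cohomologous to the image of the universal cocycle under its own
  -- integral; the gauge is then pulled back along `g`.
  have h1 : integ α₀ ((boolUniv_isCocycle α₀).map (integ α₀ hc)) = integ α₀ hc := by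
    rw [← map_integ (boolUniv_isCocycle _), integ_boolUniv, LinearMap.comp_id]
  obtain ⟨f, hf⟩ := exists_gauge (boolGraph_preconnected n) _ _ h1
  rw [map_integ]
  refine integ_congr _ _ (fun a => f (g a)) fun a b hab => ?_
  rcases hg (Or.inl hab) with h | h
  · exact hf _ _ h
  · simp only [h, (boolUniv_isCocycle α₀).diag, hc.diag, map_zero]
    abel

theorem retr_incl (z : A1ab (boolGraph m) ρ₀) : retr σ₀ ρ₀ (incl σ₀ ρ₀ z) = z := by
  have h := integ_map_comp σ₀ ρ₀ ((boolUniv_isCocycle ρ₀).comp (erase_ae (m := m)))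
    (insLast_ae (m := m))
  have h2 : integ ρ₀ (((boolUniv_isCocycle ρ₀).comp (erase_ae (m := m))).comp
      (insLast_ae (m := m))) = integ ρ₀ (boolUniv_isCocycle ρ₀) := by
    refine integ_congr _ _ 0 fun a b _ => ?_
    have e (a : Equiv.Perm (Fin m)) : erase (insLast m a) = a := erase_ins _ _
    simp [e]
  rw [h2, integ_boolUniv] at h
  exact LinearMap.congr_fun h z

theorem retr_eq_zero {z : A1ab (boolGraph (m + 1)) σ₀} (hz : z ∈ verticalSpan σ₀) :
    retr σ₀ ρ₀ z = 0 := by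
  have : verticalSpan σ₀ ≤ LinearMap.ker (retr σ₀ ρ₀) := by
    refine Submodule.span_le.2 fun x hx => ?_
    obtain ⟨σ, C, hC, rfl⟩ := mem_cycleClasses_iff.1 hx
    rw [SetLike.mem_coe, LinearMap.mem_ker, retr_walkSum]
    exact walkSum_erase_of_isVertical (boolUniv_isCocycle ρ₀) hC
  exact this hz

/-- The span of the standard vertical hexagons. -/
noncomputable def vertHexSpan : Submodule ℤ (A1ab (boolGraph (m + 1)) σ₀) :=
  Submodule.span ℤ {x | ∃ (k k' : Fin m) (hk : k.val + 1 = k'.val) (ρ : Equiv.Perm (Fin m)),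
    x = walkSum (boolUniv σ₀) (vertHex hk ρ)}

theorem vertHexSpan_le : vertHexSpan σ₀ ≤ verticalSpan σ₀ := by
  refine Submodule.span_mono ?_
  rintro _ ⟨k, k', hk, ρ, rfl⟩
  exact mem_cycleClasses_iff.2 ⟨_, _, vertHex_isVertical hk ρ, rfl⟩

/-- Modulo the standard hexagons the universal cocycle vanishes on all of them. By `push_adj` it is
then cohomologous to its pullback under erasing and reinserting at the end, so the projection `q`
equals `q ∘ incl ∘ retr`. -/
theorem sub_incl_retr_mem (z : A1ab (boolGraph (m + 1)) σ₀) :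
    z - incl σ₀ ρ₀ (retr σ₀ ρ₀ z) ∈ vertHexSpan σ₀ := by
  let q := (vertHexSpan σ₀).mkQ
  have hw := (boolUniv_isCocycle σ₀).map q
  have hex : ∀ {k k' : Fin m} (hk : k.val + 1 = k'.val) (ρ),
      walkSum (fun a b => q (boolUniv σ₀ a b)) (vertHex hk ρ) = 0 := by
    intro k k' hk ρ
    rw [← walkSum_hom, Submodule.mkQ_apply, Submodule.Quotient.mk_eq_zero]
    exact Submodule.subset_span ⟨k, k', hk, ρ, rfl⟩
  have h1 : q = integ σ₀ hw := by
    rw [← map_integ (boolUniv_isCocycle _), integ_boolUniv, LinearMap.comp_id]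
  have h2 : q ∘ₗ incl σ₀ ρ₀ ∘ₗ retr σ₀ ρ₀ = integ σ₀ ((hw.comp insLast_ae).comp erase_ae) := by
    rw [← integ_map_comp ρ₀ σ₀ (hw.comp insLast_ae) erase_ae, ← LinearMap.comp_assoc, incl,
      map_integ]
    rfl
  have h3 : q = q ∘ₗ incl σ₀ ρ₀ ∘ₗ retr σ₀ ρ₀ := by
    rw [h2]
    nth_rw 1 [h1]
    exact integ_congr _ _ (fun σ => pushSum _ (level σ).val (erase σ)) fun a b => push_adj hw hex
  rw [← Submodule.Quotient.mk_eq_zero, Submodule.Quotient.mk_sub, sub_eq_zero]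
  exact LinearMap.congr_fun h3 z

theorem mem_vertHexSpan_iff {z : A1ab (boolGraph (m + 1)) σ₀} :
    z ∈ vertHexSpan σ₀ ↔ retr σ₀ ρ₀ z = 0 := by
  refine ⟨fun h => retr_eq_zero σ₀ ρ₀ (vertHexSpan_le σ₀ h), fun h => ?_⟩
  simpa [h] using sub_incl_retr_mem σ₀ ρ₀ z

/-- Both spans lie between the span of the standard hexagons and the kernel of `retr`, which
coincide. Arbitrary vertical cycles thus need no classification. -/
theorem verticalSpan_eq : verticalSpan σ₀ = vertHexSpan σ₀ :=
  le_antisymm (fun _ hz => (mem_vertHexSpan_iff σ₀ 1).2 (retr_eq_zero σ₀ 1 hz)) (vertHexSpan_le σ₀)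

end Decomposition
-- A criterion for cocycles on the permutahedron graph
section Squares

variable {n : ℕ}

theorem swap_val_spec {i i' : Fin n} (h : i.val + 1 = i'.val) (x : Fin n) :
    (x.val = i.val ∧ (Equiv.swap i i' x).val = i.val + 1) ∨
    (x.val = i.val + 1 ∧ (Equiv.swap i i' x).val = i.val) ∨
    (x.val ≠ i.val ∧ x.val ≠ i.val + 1 ∧ (Equiv.swap i i' x).val = x.val) := by
  rw [Equiv.swap_apply_def]
  split_ifs with h1 h2
  · left; rw [h1]; exact ⟨rfl, h.symm⟩
  · right; left; rw [h2]; exact ⟨h.symm, rfl⟩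
  · right; right
    exact ⟨fun e => h1 (Fin.ext e), fun e => h2 (Fin.ext (e.trans h)), rfl⟩

/-- Two factorizations of a permutation into two simple transpositions. -/
theorem swap_mul_swap_eq {i i' j j' k k' l l' : Fin n} (hi : i.val + 1 = i'.val)
    (hj : j.val + 1 = j'.val) (hk : k.val + 1 = k'.val) (hl : l.val + 1 = l'.val)
    (H : Equiv.swap i i' * Equiv.swap j j' = Equiv.swap l l' * Equiv.swap k k')
    (h1 : i.val ≠ l.val) (h2 : i.val ≠ j.val) :
    (i'.val < j.val ∨ j'.val < i.val) ∧ l.val = j.val ∧ k.val = i.val := by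
  have H' (x : Fin n) : (Equiv.swap i i' (Equiv.swap j j' x)).val =
      (Equiv.swap l l' (Equiv.swap k k' x)).val := by
    rw [← Equiv.Perm.mul_apply, H, Equiv.Perm.mul_apply]
  -- For overlapping transpositions the left side moves some point by two positions. The right side
  -- can do this only with `k = j` and `l = i`, against `h1`.
  by_cases c1 : j.val = i.val + 1
  · have := H' j'
    have := swap_val_spec hj j'
    have := swap_val_spec hi (Equiv.swap j j' j')
    have := swap_val_spec hk j'
    have := swap_val_spec hl (Equiv.swap k k' j')
    omega
  by_cases c2 : i.val = j.val + 1
  · have := H' j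
    have := swap_val_spec hj j
    have := swap_val_spec hi (Equiv.swap j j' j)
    have := swap_val_spec hk j
    have := swap_val_spec hl (Equiv.swap k k' j)
    omega
  have hki : k.val = i.val := by
    have := H' i
    have := swap_val_spec hj i
    have := swap_val_spec hi (Equiv.swap j j' i)
    have := swap_val_spec hk i
    have := swap_val_spec hl (Equiv.swap k k' i)
    omega
  have hlj : l.val = j.val := by
    have := H' j
    have := swap_val_spec hj j
    have := swap_val_spec hi (Equiv.swap j j' j)
    have := swap_val_spec hk j
    have := swap_val_spec hl (Equiv.swap k k' j)
    omega
  exact ⟨by omega, hlj, hki⟩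

theorem sign_adj {σ τ : Equiv.Perm (Fin n)} (h : (boolGraph n).Adj σ τ) :
    Equiv.Perm.sign τ = - Equiv.Perm.sign σ := by
  obtain ⟨i, j, hij, rfl⟩ := h
  rw [Equiv.Perm.sign_mul, Equiv.Perm.sign_swap (fun e => by subst e; omega), mul_neg, mul_one]

/-- An antisymmetric function is a cocycle if it takes equal values on opposite edges of the squares
given by commuting simple transpositions. -/
theorem isCocycle_of_commuting {M : Type*} [AddCommGroup M]
    {c : Equiv.Perm (Fin n) → Equiv.Perm (Fin n) → M} (hd : ∀ a, c a a = 0)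
    (ha : ∀ a b, c b a = - c a b)
    (hc : ∀ (a : Equiv.Perm (Fin n)) (i i' j j' : Fin n), i.val + 1 = i'.val → j.val + 1 = j'.val →
      (i'.val < j.val ∨ j'.val < i.val) →
      c a (a * Equiv.swap i i') =
        c (a * Equiv.swap j j') (a * Equiv.swap j j' * Equiv.swap i i')) :
    IsCocycle (boolGraph n) c := by
  -- Edges change the sign, so there are no triangles: a closed walk of length three contains a
  -- pause.
  have tri : ∀ {a b d}, AE (boolGraph n) a b → AE (boolGraph n) b d → AE (boolGraph n) d a →
      c a b + c b d + c d a = 0 := by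
    intro a b d h1 h2 h3
    rcases h1 with h1 | rfl
    · rcases h2 with h2 | rfl
      · rcases h3 with h3 | rfl
        · have s1 := sign_adj h1
          have s2 := sign_adj h2
          have s3 := sign_adj h3
          rw [s2, s1, neg_neg] at s3
          rcases Int.units_eq_one_or (Equiv.Perm.sign a) with h | h <;> rw [h] at s3 <;>
            exact absurd s3 (by decide)
        · rw [hd, ha d b]; simp
      · rw [hd, ha a b]; simp
    · rw [hd, ha a d]; simp
  refine ⟨hd, fun {a b b' d} h1 h2 h3 h4 => ?_⟩
  rcases h1 with h1 | rfl
  swap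
  · rw [hd, zero_add, tri h2 h3 h4]
  rcases h2 with h2 | rfl
  swap
  · rw [hd, add_zero, tri (Or.inl h1) h3 h4]
  rcases h3 with h3 | rfl
  swap
  · rw [hd, add_zero, tri (Or.inl h1) (Or.inl h2) h4]
  rcases h4 with h4 | rfl
  swap
  · rw [hd, add_zero, tri (Or.inl h1) (Or.inl h2) (Or.inl h3)]
  obtain ⟨i, i', hi, rfl⟩ := h1
  obtain ⟨l, l', hl, rfl⟩ := h4.symm
  obtain ⟨j, j', hj, rfl⟩ := h2
  obtain ⟨k, k', hk, hkk⟩ := h3.symm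
  -- Apart from the backtracking cases `i = l` and `i = j`, the square comes from two commuting
  -- transpositions.
  by_cases hil : i.val = l.val
  · obtain rfl : i = l := Fin.ext hil
    obtain rfl : i' = l' := Fin.ext (by omega)
    rw [ha (a * _) a, ha (a * _ * _)]
    abel
  by_cases hij : i.val = j.val
  · obtain rfl : i = j := Fin.ext hij
    obtain rfl : i' = j' := Fin.ext (by omega)
    rw [mul_assoc, Equiv.swap_mul_self, mul_one, ha a, ha a]
    abel
  have H : Equiv.swap i i' * Equiv.swap j j' = Equiv.swap l l' * Equiv.swap k k' := by
    rw [mul_assoc, mul_assoc] at hkk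
    exact mul_left_cancel hkk
  obtain ⟨hdis, hlj, hki⟩ := swap_mul_swap_eq hi hj hk hl H hil hij
  obtain rfl : l = j := Fin.ext hlj
  obtain rfl : l' = j' := Fin.ext (by omega)
  obtain rfl : k = i := Fin.ext hki
  obtain rfl : k' = i' := Fin.ext (by omega)
  have e1 := hc a k k' l l' hi hj hdis
  have e2 := hc a l l' k k' hj hi hdis.symm
  rw [← hkk] at e1
  rw [e1, ← e2, ha (a * _ * _), ha a]
  abel

end Squares

/-! ### Cocycles counting crossings of two letters -/

section Crossing

variable {n : ℕ}

/-- On the edge from `σ` to `τ` the neighbouring letters `x`, `y` are exchanged, and the letters to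
the left of them form the set `U`. -/
def Crosses (U : Finset (Fin n)) (x y : Fin n) (σ τ : Equiv.Perm (Fin n)) : Prop :=
  τ = Equiv.swap x y * σ ∧ (σ⁻¹ x).val + 1 = (σ⁻¹ y).val ∧ ∀ z, σ⁻¹ z < σ⁻¹ x ↔ z ∈ U

variable {U : Finset (Fin n)} {x y : Fin n} {σ : Equiv.Perm (Fin n)}

theorem crosses_mul_swap_iff {i i' : Fin n} (h : i.val + 1 = i'.val) :
    Crosses U x y σ (σ * Equiv.swap i i') ↔
      σ i = x ∧ σ i' = y ∧ ∀ z, σ⁻¹ z < i ↔ z ∈ U := by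
  constructor
  · rintro ⟨h1, h2, h3⟩
    rw [Equiv.swap_mul_eq_mul_swap] at h1
    have h1 := mul_left_cancel h1
    have e : (Equiv.swap i i' (σ⁻¹ x)).val = (σ⁻¹ x).val + 1 := by
      rw [h1, Equiv.swap_apply_left, h2]
    have s := swap_val_spec h (σ⁻¹ x)
    have hx : σ⁻¹ x = i := Fin.ext (by omega)
    have hy : σ⁻¹ y = i' := Fin.ext (by omega)
    refine ⟨by rw [← hx]; simp, by rw [← hy]; simp, by rwa [hx] at h3⟩
  · rintro ⟨rfl, rfl, h3⟩
    exact ⟨Equiv.mul_swap_eq_swap_mul _ _ _, by simpa using h, by simpa using h3⟩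

/-- The swapped positions `j, j'` lie both to the left of `i` or both to the right of `i'`, so the
set of letters to the left of `i` is unchanged. Hence opposite edges of a commuting square have the
same crossings. -/
theorem crosses_commute {i i' j j' : Fin n} (hi : i.val + 1 = i'.val) (hj : j.val + 1 = j'.val)
    (hij : i'.val < j.val ∨ j'.val < i.val) (h : Crosses U x y σ (σ * Equiv.swap i i')) :
    Crosses U x y (σ * Equiv.swap j j') (σ * Equiv.swap j j' * Equiv.swap i i') := by
  rw [crosses_mul_swap_iff hi] at h ⊢
  obtain ⟨h1, h2, h3⟩ := h
  have e1 : Equiv.swap j j' i = i := Fin.ext (by have := swap_val_spec hj i; omega)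
  have e2 : Equiv.swap j j' i' = i' := Fin.ext (by have := swap_val_spec hj i'; omega)
  refine ⟨by simpa [e1], by simpa [e2], fun z => ?_⟩
  rw [← h3, mul_inv_rev, Equiv.swap_inv, Equiv.Perm.mul_apply, Fin.lt_def, Fin.lt_def]
  have := swap_val_spec hj (σ⁻¹ z)
  omega

theorem swap_commute {i i' j j' : Fin n} (hi : i.val + 1 = i'.val) (hj : j.val + 1 = j'.val)
    (hij : i'.val < j.val ∨ j'.val < i.val) :
    Equiv.swap i i' * Equiv.swap j j' = Equiv.swap j j' * Equiv.swap i i' := by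
  ext z
  rw [Equiv.Perm.mul_apply, Equiv.Perm.mul_apply]
  have := swap_val_spec hj z
  have := swap_val_spec hi z
  have := swap_val_spec hi (Equiv.swap j j' z)
  have := swap_val_spec hj (Equiv.swap i i' z)
  omega

theorem crosses_commute_iff {i i' j j' : Fin n} (hi : i.val + 1 = i'.val)
    (hj : j.val + 1 = j'.val) (hij : i'.val < j.val ∨ j'.val < i.val) :
    Crosses U x y σ (σ * Equiv.swap i i') ↔
      Crosses U x y (σ * Equiv.swap j j') (σ * Equiv.swap j j' * Equiv.swap i i') := by
  refine ⟨crosses_commute hi hj hij, fun h => ?_⟩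
  have := crosses_commute hi hj hij h
  rwa [mul_assoc σ, Equiv.swap_mul_self, mul_one] at this

open Classical in
/-- The cocycle which counts the crossings of `x` and `y` with the set `U` to the left. -/
noncomputable def crossing (U : Finset (Fin n)) (x y : Fin n) (σ τ : Equiv.Perm (Fin n)) : ℤ :=
  (if Crosses U x y σ τ then 1 else 0) - (if Crosses U x y τ σ then 1 else 0)

theorem crossing_isCocycle (U : Finset (Fin n)) (x y : Fin n) :
    IsCocycle (boolGraph n) (crossing U x y) := by
  refine isCocycle_of_commuting (fun a => sub_self _) (fun a b => by simp [crossing]) ?_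
  intro a i i' j j' hi hj hij
  have h1 := crosses_commute_iff (U := U) (x := x) (y := y) (σ := a) hi hj hij
  have h2 := crosses_commute_iff (U := U) (x := x) (y := y) (σ := a * Equiv.swap i i') hi hj hij
  have e1 : a * Equiv.swap i i' * Equiv.swap j j' = a * Equiv.swap j j' * Equiv.swap i i' := by
    rw [mul_assoc, mul_assoc, swap_commute hi hj hij]
  have e2 (b : Equiv.Perm (Fin n)) : b * Equiv.swap i i' * Equiv.swap i i' = b := by
    rw [mul_assoc, Equiv.swap_mul_self, mul_one]
  rw [e1, e2, e2] at h2
  classical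
  rw [crossing, crossing]
  congr 1
  · exact if_congr h1 rfl rfl
  · exact if_congr h2 rfl rfl

end Crossing

/-! ### Dual cocycles of the vertical hexagons -/

section Vertical

variable {m : ℕ}

/-- The letters to the left of position `k`, and the letters at the positions `k`, `k'`. -/
def hexType (k k' : Fin m) (ρ : Equiv.Perm (Fin m)) : Finset (Fin m) × Fin m × Fin m :=
  ((Finset.Iio k).map ρ.toEmbedding, ρ k, ρ k')

theorem mem_hexType {k k' : Fin m} {ρ : Equiv.Perm (Fin m)} {z : Fin m} :
    z ∈ (hexType k k' ρ).1 ↔ ρ⁻¹ z < k := by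
  rw [hexType, Finset.mem_map_equiv, Finset.mem_Iio]
  rfl

/-- The cocycle dual to the vertical hexagons of type `t`. -/
noncomputable def dualCocycle (t : Finset (Fin m) × Fin m × Fin m) :
    Equiv.Perm (Fin (m + 1)) → Equiv.Perm (Fin (m + 1)) → ℤ :=
  -- Requiring the largest letter on the left selects the swap edge at the lowest level of a hexagon
  -- and excludes the one at its highest level.
  crossing (insert (Fin.last m) (t.1.map Fin.castSuccEmb)) t.2.1.castSucc t.2.2.castSucc

theorem dualCocycle_isCocycle (t : Finset (Fin m) × Fin m × Fin m) :
    IsCocycle (boolGraph (m + 1)) (dualCocycle t) := crossing_isCocycle _ _ _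

theorem not_crosses_of_level_ne {U : Finset (Fin (m + 1))} {x y : Fin m}
    {σ τ : Equiv.Perm (Fin (m + 1))} (h : level σ ≠ level τ) :
    ¬ Crosses U x.castSucc y.castSucc σ τ := by
  rintro ⟨rfl, -, -⟩
  apply h
  rw [level, level, mul_inv_rev, Equiv.Perm.mul_apply, Equiv.swap_inv,
    Equiv.swap_apply_of_ne_of_ne (Fin.castSucc_lt_last x).ne' (Fin.castSucc_lt_last y).ne']

theorem dualCocycle_of_level_ne (t : Finset (Fin m) × Fin m × Fin m)
    {σ τ : Equiv.Perm (Fin (m + 1))} (h : level σ ≠ level τ) : dualCocycle t σ τ = 0 := by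
  rw [dualCocycle, crossing, if_neg (not_crosses_of_level_ne h),
    if_neg (not_crosses_of_level_ne h.symm), sub_zero]

theorem not_crosses_top (t : Finset (Fin m) × Fin m × Fin m) {k k' : Fin m}
    (hk : k.val + 1 = k'.val) (ρ : Equiv.Perm (Fin m)) :
    ¬ Crosses (insert (Fin.last m) (t.1.map Fin.castSuccEmb)) t.2.1.castSucc t.2.2.castSucc
      (ins k'.succ ρ) (ins k'.succ (ρ * Equiv.swap k k')) := by
  rw [ins_top_swap hk, crosses_mul_swap_iff (by simp)]
  rintro ⟨-, -, h⟩
  have h1 := (h (Fin.last m)).2 (by simp)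
  have h2 : (ins k'.succ ρ)⁻¹ (Fin.last m) = k'.succ := level_ins _ _
  rw [h2, Fin.lt_def] at h1
  simp at h1
  omega

theorem crosses_bot_iff (t : Finset (Fin m) × Fin m × Fin m) {k k' : Fin m}
    (hk : k.val + 1 = k'.val) (ρ : Equiv.Perm (Fin m)) :
    Crosses (insert (Fin.last m) (t.1.map Fin.castSuccEmb)) t.2.1.castSucc t.2.2.castSucc
      (ins k.castSucc ρ) (ins k.castSucc (ρ * Equiv.swap k k')) ↔ hexType k k' ρ = t := by
  have e1 : k.succ = k.castSucc.succAbove k := by simp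
  have e2 : k'.succ = k.castSucc.succAbove k' :=
    Fin.ext ((succAbove_of_ge (by simp; omega)).trans (by simp)).symm
  rw [ins_bot_swap hk, crosses_mul_swap_iff (by simp [hk])]
  have hs : (∀ z, (ins k.castSucc ρ)⁻¹ z < k.succ ↔
      z ∈ insert (Fin.last m) (t.1.map Fin.castSuccEmb)) ↔ (hexType k k' ρ).1 = t.1 := by
    rw [Fin.forall_fin_succ']
    have hlast : (ins k.castSucc ρ)⁻¹ (Fin.last m) = k.castSucc := level_ins _ _
    have hcast (z : Fin m) : (ins k.castSucc ρ)⁻¹ z.castSucc = k.castSucc.succAbove (ρ⁻¹ z) := by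
      rw [Equiv.Perm.inv_eq_iff_eq, ins_succAbove]
      simp
    have hlt (p : Fin m) : k.castSucc.succAbove p < k.succ ↔ p < k := by
      rw [Fin.lt_def, Fin.lt_def]
      rcases lt_or_ge p.val k.val with h | h
      · rw [succAbove_of_lt (by simpa using h), Fin.val_succ]; omega
      · rw [succAbove_of_ge (by simpa using h), Fin.val_succ]; omega
    simp only [hlast, hcast, hlt, Finset.ext_iff, mem_hexType]
    simp [(Fin.castSucc_lt_last _).ne]
  rw [hs, e1, e2, ins_succAbove, ins_succAbove, Fin.castSucc_inj, Fin.castSucc_inj, Prod.ext_iff,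
    Prod.ext_iff]
  simp only [hexType]
  tauto

/-- Only the last edge of the hexagon, the swap at its lowest level, can contribute. It is traversed
towards `ρ`, hence the sign. The two order conditions exclude a crossing in the opposite direction.
-/
theorem dualCocycle_vertHex {t : Finset (Fin m) × Fin m × Fin m} (ht : t.2.1 < t.2.2)
    {k k' : Fin m} (hk : k.val + 1 = k'.val) {ρ : Equiv.Perm (Fin m)} (hρ : ρ k < ρ k') :
    walkSum (dualCocycle t) (vertHex hk ρ) = if hexType k k' ρ = t then -1 else 0 := by
  have h1 (ρ) : dualCocycle t (ins k.castSucc ρ) (ins k.succ ρ) = 0 :=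
    dualCocycle_of_level_ne t (by simp [Fin.ext_iff])
  have h2 (ρ) : dualCocycle t (ins k.succ ρ) (ins k'.succ ρ) = 0 :=
    dualCocycle_of_level_ne t (by simp [Fin.ext_iff]; omega)
  have h3 (ρ) : dualCocycle t (ins k'.succ ρ) (ins k.succ ρ) = 0 :=
    dualCocycle_of_level_ne t (by simp [Fin.ext_iff]; omega)
  have h4 (ρ) : dualCocycle t (ins k.succ ρ) (ins k.castSucc ρ) = 0 :=
    dualCocycle_of_level_ne t (by simp [Fin.ext_iff])
  obtain ⟨ρ', hρ'⟩ : ∃ ρ', ρ' = ρ * Equiv.swap k k' := ⟨_, rfl⟩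
  have hss : ρ = ρ' * Equiv.swap k k' := by
    rw [hρ', mul_assoc, Equiv.swap_mul_self, mul_one]
  have ht1 := not_crosses_top t hk ρ
  have ht2 := not_crosses_top t hk ρ'
  have hb1 := crosses_bot_iff t hk ρ
  have hb2 := crosses_bot_iff t hk ρ'
  rw [← hρ'] at ht1 hb1
  rw [← hss] at ht2 hb2
  have h5 : dualCocycle t (ins k'.succ ρ) (ins k'.succ ρ') = 0 := by
    rw [dualCocycle, crossing, if_neg ht1, if_neg ht2, sub_zero]
  have h6 : ¬ hexType k k' ρ' = t := by
    rintro rfl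
    rw [hρ'] at ht
    simp [hexType] at ht
    exact absurd hρ ht.asymm
  have h7 : dualCocycle t (ins k.castSucc ρ') (ins k.castSucc ρ) =
      if hexType k k' ρ = t then -1 else 0 := by
    rw [dualCocycle, crossing, if_neg (mt hb2.1 h6)]
    simp only [hb1]
    split_ifs <;> simp
  simp only [vertHex, walkSum, ← hρ', h1, h2, h3, h4, h5, h7, zero_add, add_zero]

end Vertical
-- A vertical hexagon depends only on its type
section HexType

variable {m : ℕ} {M : Type*} [AddCommGroup M]
  {w : Equiv.Perm (Fin (m + 1)) → Equiv.Perm (Fin (m + 1)) → M}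

/-- Exchanging the two letters gives the same hexagon with the opposite orientation. -/
theorem walkSum_vertHex_swap (hw : IsCocycle (boolGraph (m + 1)) w) {k k' : Fin m}
    (hk : k.val + 1 = k'.val) (ρ : Equiv.Perm (Fin m)) :
    walkSum w (vertHex hk (ρ * Equiv.swap k k')) = - walkSum w (vertHex hk ρ) := by
  obtain ⟨ρ', hρ'⟩ : ∃ ρ', ρ' = ρ * Equiv.swap k k' := ⟨_, rfl⟩
  have hss : ρ' * Equiv.swap k k' = ρ := by
    rw [hρ', mul_assoc, Equiv.swap_mul_self, mul_one]
  have e : k.succ = k'.castSucc := Fin.ext (by simp [hk])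
  have ha (ρ : Equiv.Perm (Fin m)) := hw.antisymm (Or.inl (adj_ins_succ k ρ))
  have hb (ρ : Equiv.Perm (Fin m)) := hw.antisymm (Or.inl (adj_ins_succ k' ρ))
  rw [← e] at hb
  have hc := hw.antisymm (Or.inl (adj_ins_swap (l := k'.succ) hk (by simp) ρ))
  have hd := hw.antisymm (Or.inl (adj_ins_swap (l := k.castSucc) hk (by simp; omega) ρ))
  rw [← hρ'] at hc hd ⊢
  simp only [vertHex, walkSum, hss, ← hρ', ha, hb, hc, hd]
  abel

/-- A swap away from the two letters commutes with all moves of the hexagon. The two hexagons are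
the ends of a prism with six square sides, and its connecting edges cancel. -/
theorem walkSum_vertHex_mul_swap (hw : IsCocycle (boolGraph (m + 1)) w) {k k' : Fin m}
    (hk : k.val + 1 = k'.val) {j j' : Fin m} (hj : j.val + 1 = j'.val)
    (hd : k'.val < j.val ∨ j'.val < k.val) (ρ : Equiv.Perm (Fin m)) :
    walkSum w (vertHex hk (ρ * Equiv.swap j j')) = walkSum w (vertHex hk ρ) := by
  have e : k.succ = k'.castSucc := Fin.ext (by simp [hk])
  have sq {x y x' y' : Equiv.Perm (Fin (m + 1))} (h1 : (boolGraph (m + 1)).Adj x y)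
      (h2 : (boolGraph (m + 1)).Adj x' y') (h3 : (boolGraph (m + 1)).Adj x x')
      (h4 : (boolGraph (m + 1)).Adj y y') : w x' y' = - w x x' + w x y + w y y' := by
    have := hw.square (Or.inl h1) (Or.inl h4) (Or.inl h2.symm) (Or.inl h3.symm)
    rw [hw.antisymm (Or.inl h2), hw.antisymm (Or.inl h3)] at this
    rw [← sub_eq_zero, ← neg_eq_zero, ← this]
    abel
  obtain ⟨τ, hτ⟩ : ∃ τ, τ = ρ * Equiv.swap k k' := ⟨_, rfl⟩
  obtain ⟨ρ', hρ'⟩ : ∃ ρ', ρ' = ρ * Equiv.swap j j' := ⟨_, rfl⟩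
  obtain ⟨τ', hτ'⟩ : ∃ τ', τ' = ρ' * Equiv.swap k k' := ⟨_, rfl⟩
  have hττ' : τ' = τ * Equiv.swap j j' := by
    rw [hτ', hτ, hρ', mul_assoc, mul_assoc, swap_commute hk hj hd]
  have a1 (ρ) := adj_ins_succ k ρ
  have a2 (ρ) := adj_ins_succ k' ρ
  rw [← e] at a2
  have p (l : Fin (m + 1)) (hl : l.val ≠ j'.val) : (boolGraph (m + 1)).Adj (ins l ρ) (ins l ρ') :=
    hρ' ▸ adj_ins_swap hj hl ρ
  have q (l : Fin (m + 1)) (hl : l.val ≠ j'.val) : (boolGraph (m + 1)).Adj (ins l τ) (ins l τ') :=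
    hττ' ▸ adj_ins_swap hj hl τ
  have r (l : Fin (m + 1)) (hl : l.val ≠ k'.val) : (boolGraph (m + 1)).Adj (ins l ρ) (ins l τ) :=
    hτ ▸ adj_ins_swap hk hl ρ
  have r' (l : Fin (m + 1)) (hl : l.val ≠ k'.val) :
      (boolGraph (m + 1)).Adj (ins l ρ') (ins l τ') := hτ' ▸ adj_ins_swap hk hl ρ'
  have n0 : k.castSucc.val ≠ j'.val := by simp; omega
  have n1 : k.succ.val ≠ j'.val := by simp; omega
  have n2 : k'.succ.val ≠ j'.val := by simp; omega
  have t0 : k.castSucc.val ≠ k'.val := by simp; omega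
  have t2 : k'.succ.val ≠ k'.val := by simp
  rw [← hρ']
  simp only [vertHex, walkSum, ← hτ, ← hτ']
  rw [sq (a1 ρ) (a1 ρ') (p _ n0) (p _ n1), sq (a2 ρ) (a2 ρ') (p _ n1) (p _ n2),
    sq (r _ t2) (r' _ t2) (p _ n2) (q _ n2), sq (a2 τ).symm (a2 τ').symm (q _ n2) (q _ n1),
    sq (a1 τ).symm (a1 τ').symm (q _ n1) (q _ n0), sq (r _ t0).symm (r' _ t0).symm (q _ n0) (p _ n0)]
  abel

/-- Permutations which preserve the fibres of a monotone function are generated by the simple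
transpositions with this property. -/
theorem mem_closure_swap_of_monotone {β : Fin m → ℕ} (hβ : Monotone β) {π : Equiv.Perm (Fin m)}
    (hπ : ∀ p, β (π p) = β p) :
    π ∈ Subgroup.closure {f | ∃ j j' : Fin m, j.val + 1 = j'.val ∧ β j = β j' ∧
      f = Equiv.swap j j'} := by
  set S : Set (Equiv.Perm (Fin m)) := {f | ∃ j j' : Fin m, j.val + 1 = j'.val ∧ β j = β j' ∧
      f = Equiv.swap j j'} with hS
  -- A group generated by transpositions contains every finitely supported permutation which
  -- preserves its orbits. The fibres of a monotone function are intervals, so neighbour swaps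
  -- connect each of them.
  rw [mem_closure_isSwap]
  · refine ⟨Set.toFinite _, fun x => ?_⟩
    have key : ∀ (d : ℕ) (x y : Fin m), x.val + d = y.val → β x = β y →
        x ∈ MulAction.orbit (Subgroup.closure S) y := by
      intro d
      induction d with
      | zero =>
        intro x y h _
        obtain rfl : x = y := Fin.ext (by simpa using h)
        exact MulAction.mem_orbit_self _
      | succ d ih =>
        intro x y h hxy
        have hlt : x.val + d < m := by omega
        have h1 : β x ≤ β ⟨x.val + d, hlt⟩ := hβ (Fin.le_def.2 (by simp))
        have h2 : β ⟨x.val + d, hlt⟩ ≤ β y := hβ (Fin.le_def.2 (by simp; omega))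
        have h3 := ih x ⟨x.val + d, hlt⟩ rfl (by omega)
        rw [← MulAction.orbit_eq_iff] at h3 ⊢
        rw [h3, MulAction.orbit_eq_iff]
        have hmem : Equiv.swap ⟨x.val + d, hlt⟩ y ∈ S := ⟨_, _, show x.val + d + 1 = y.val by omega, by omega, rfl⟩
        exact ⟨⟨_, Subgroup.subset_closure hmem⟩, Equiv.swap_apply_right _ _⟩
    rcases le_total (π x) x with h | h
    · exact key (x.val - (π x).val) _ _ (by have := Fin.le_def.1 h; omega) (hπ x)
    · rw [MulAction.mem_orbit_symm]
      exact key ((π x).val - x.val) _ _ (by have := Fin.le_def.1 h; omega) (hπ x).symm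
  · rintro _ ⟨j, j', h, -, rfl⟩
    exact ⟨j, j', fun e => by subst e; omega, rfl⟩

/-- The class of a vertical hexagon depends only on its type. -/
theorem walkSum_vertHex_congr (hw : IsCocycle (boolGraph (m + 1)) w) {k k' l l' : Fin m}
    (hk : k.val + 1 = k'.val) (hl : l.val + 1 = l'.val) {ρ τ : Equiv.Perm (Fin m)}
    (h : hexType k k' ρ = hexType l l' τ) :
    walkSum w (vertHex hk ρ) = walkSum w (vertHex hl τ) := by
  -- The number of letters to the left recovers the position.
  have hkl : k = l := by
    have := congrArg (fun t => t.1.card) h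
    simp only [hexType, Finset.card_map, Fin.card_Iio] at this
    exact Fin.ext this
  subst hkl
  obtain rfl : k' = l' := Fin.ext (by omega)
  obtain ⟨π, rfl⟩ : ∃ π, τ = ρ * π := ⟨ρ⁻¹ * τ, by simp⟩
  have h1 : π k = k := by simpa [hexType] using (congrArg (fun t => t.2.1) h).symm
  have h2 : π k' = k' := by simpa [hexType] using (congrArg (fun t => t.2.2) h).symm
  have h3 (p : Fin m) : π p < k ↔ p < k := by
    have h4 := mem_hexType (k := k) (k' := k') (ρ := ρ) (z := ρ (π p))
    rw [h, mem_hexType] at h4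
    simpa using h4.symm
  -- Equal types mean that `π` fixes `k` and `k'` and preserves the blocks on either side. Neighbour
  -- swaps inside a block are exactly those covered by the prism lemma.
  let β (p : Fin m) : ℕ := if p < k then 0 else if p = k then 1 else if p = k' then 2 else 3
  have hβ : Monotone β := by
    intro p q hpq
    have := Fin.le_def.1 hpq
    simp only [β, Fin.lt_def, Fin.ext_iff]
    split_ifs <;> omega
  have hπ (p : Fin m) : β (π p) = β p := by
    have e1 : π p = k ↔ p = k := by nth_rw 1 [← h1]; exact π.apply_eq_iff_eq
    have e2 : π p = k' ↔ p = k' := by nth_rw 1 [← h2]; exact π.apply_eq_iff_eq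
    simp only [β, h3, e1, e2]
  have hmem := mem_closure_swap_of_monotone hβ hπ
  clear h h1 h2 h3 hπ
  have gen (ρ : Equiv.Perm (Fin m)) {j j' : Fin m} (hj : j.val + 1 = j'.val) (hjj : β j = β j') :
      walkSum w (vertHex hk (ρ * Equiv.swap j j')) = walkSum w (vertHex hk ρ) := by
    refine walkSum_vertHex_mul_swap hw hk hj ?_ ρ
    simp only [β, Fin.lt_def, Fin.ext_iff] at hjj
    split_ifs at hjj <;> omega
  induction hmem using Subgroup.closure_induction generalizing ρ with
  | mem f hf =>
    obtain ⟨j, j', hj, hjj, rfl⟩ := hf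
    exact (gen ρ hj hjj).symm
  | one => rw [mul_one]
  | mul f g _ _ hf hg => rw [hf, hg (ρ := ρ * f), mul_assoc]
  | inv f _ hf => rw [hf (ρ := ρ * f⁻¹), mul_assoc, inv_mul_cancel, mul_one]

end HexType

/-! ### Bases of hexagon classes -/

section Basis

variable {m : ℕ} (σ₀ : Equiv.Perm (Fin (m + 1)))

/-- The vertical hexagons contain a finite basis of their span. -/
theorem exists_vertical_basis : ∃ T : Set (A1ab (boolGraph (m + 1)) σ₀),
    T ⊆ cycleClasses σ₀ (fun _ C => IsVertical C) ∧ T.Finite ∧ LinearIndepOn ℤ id T ∧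
      Submodule.span ℤ T = vertHexSpan σ₀ := by
  -- One hexagon is chosen for each type with increasing letters; decreasing letters give only the
  -- negatives.
  let I := {t : Finset (Fin m) × Fin m × Fin m // ∃ (k k' : Fin m) (_ : k.val + 1 = k'.val)
    (ρ : Equiv.Perm (Fin m)), ρ k < ρ k' ∧ hexType k k' ρ = t}
  choose k k' hk ρ hρ ht using fun t : I => t.2
  let v (t : I) : A1ab (boolGraph (m + 1)) σ₀ := walkSum (boolUniv σ₀) (vertHex (hk t) (ρ t))
  have hord (t : I) : t.1.2.1 < t.1.2.2 := by
    have := hρ t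
    rw [← ht t]
    exact this
  have hdual (s t : I) : integ σ₀ (dualCocycle_isCocycle s.1) (v t) = if t = s then -1 else 0 := by
    rw [integ_walkSum_boolUniv, dualCocycle_vertHex (hord s) (hk t) (hρ t), ht t]
    by_cases h : t = s
    · rw [if_pos h, if_pos (congrArg _ h)]
    · rw [if_neg h, if_neg fun e => h (Subtype.ext e)]
  have hv : LinearIndependent ℤ v := by
    refine LinearIndependent.of_pairwise_dual_eq_zero_one v
      (fun s => - integ σ₀ (dualCocycle_isCocycle s.1)) (fun s t hst => ?_) (fun s => ?_)
    · change (- integ σ₀ (dualCocycle_isCocycle s.1)) (v t) = 0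
      rw [LinearMap.neg_apply, hdual, if_neg hst.symm, neg_zero]
    · rw [LinearMap.neg_apply, hdual, if_pos rfl, neg_neg]
  refine ⟨Set.range v, ?_, Set.finite_range v, hv.linearIndepOn_id, ?_⟩
  · rintro _ ⟨t, rfl⟩
    exact mem_cycleClasses_iff.2 ⟨_, _, vertHex_isVertical (hk t) (ρ t), rfl⟩
  · apply le_antisymm
    · refine Submodule.span_mono ?_
      rintro _ ⟨t, rfl⟩
      exact ⟨_, _, hk t, ρ t, rfl⟩
    · refine Submodule.span_le.2 ?_
      have key {l l' : Fin m} (hl : l.val + 1 = l'.val) (τ : Equiv.Perm (Fin m))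
          (hτ : τ l < τ l') : walkSum (boolUniv σ₀) (vertHex hl τ) ∈
            Submodule.span ℤ (Set.range v) := by
        let t : I := ⟨hexType l l' τ, l, l', hl, τ, hτ, rfl⟩
        have : walkSum (boolUniv σ₀) (vertHex hl τ) = v t :=
          walkSum_vertHex_congr (boolUniv_isCocycle σ₀) hl (hk t) (ht t).symm
        rw [this]
        exact Submodule.subset_span ⟨t, rfl⟩
      rintro _ ⟨l, l', hl, τ, rfl⟩
      rcases lt_trichotomy (τ l) (τ l') with h | h | h
      · exact key hl τ h
      · have := τ.injective h
        subst this
        omega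
      · have h1 := key hl (τ * Equiv.swap l l') (by simpa using h)
        rw [walkSum_vertHex_swap (boolUniv_isCocycle σ₀)] at h1
        exact (Submodule.neg_mem_iff _).1 h1

theorem incl_mem_topHorizontalClasses (ρ₀ : Equiv.Perm (Fin m)) {x : A1ab (boolGraph m) ρ₀}
    (hx : x ∈ cycleClasses ρ₀ (fun _ C => IsPrimitiveSixCycle C)) :
    incl σ₀ ρ₀ x ∈ topHorizontalClasses σ₀ := by
  obtain ⟨ρ, C, ⟨hC, hlen, i, j, d, hij, hjd, hlab⟩, rfl⟩ := mem_cycleClasses_iff.1 hx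
  rw [incl_walkSum]
  refine mem_cycleClasses_iff.2 ⟨_, C.map (insLast m), ⟨⟨?_, ?_, i.castSucc, j.castSucc, d.castSucc,
    hij, hjd, ?_⟩, ?_⟩, rfl⟩
  · exact hC.map (ins_injective _)
  · rw [SimpleGraph.Walk.length_map, hlen]
  · intro e he
    rw [SimpleGraph.Walk.darts_map, List.mem_map] at he
    obtain ⟨e, he, rfl⟩ := he
    have h (ρ : Equiv.Perm (Fin m)) (i j : Fin m) : insLast m (ρ * Equiv.swap i j) =
        insLast m ρ * Equiv.swap i.castSucc j.castSucc := by
      have := ins_mul_swap (Fin.last m) ρ i j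
      rwa [Fin.succAbove_last_apply, Fin.succAbove_last_apply] at this
    change insLast m e.snd = insLast m e.fst * _ ∨ insLast m e.snd = insLast m e.fst * _
    rcases hlab e he with h1 | h1
    · exact Or.inl (by rw [h1, h])
    · exact Or.inr (by rw [h1, h])
  · intro v hv
    rw [SimpleGraph.Walk.support_map, List.mem_map] at hv
    obtain ⟨v, -, rfl⟩ := hv
    exact level_ins _ _

/-- A walk in the top level is not changed by erasing and reinserting the largest letter. -/
theorem incl_retr_of_top (ρ₀ : Equiv.Perm (Fin m)) {x : A1ab (boolGraph (m + 1)) σ₀}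
    (hx : x ∈ topHorizontalClasses σ₀) : incl σ₀ ρ₀ (retr σ₀ ρ₀ x) = x := by
  obtain ⟨σ, C, hC, rfl⟩ := mem_cycleClasses_iff.1 hx
  have h := LinearMap.congr_fun (integ_map_comp ρ₀ σ₀ ((boolUniv_isCocycle σ₀).comp
    (insLast_ae (m := m))) (erase_ae (m := m))) (walkSum (boolUniv σ₀) C)
  rw [LinearMap.comp_apply] at h
  refine h.trans ?_
  rw [integ_walkSum_boolUniv]
  have e : ∀ v ∈ C.support, insLast m (erase v) = v := by
    intro v hv
    have := ins_erase v
    rwa [hC.2 v hv] at this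
  exact walkSum_congr C fun d hd => by
    rw [e _ (C.dart_fst_mem_support_of_mem_darts hd),
      e _ (C.dart_snd_mem_support_of_mem_darts hd)]

/-- Since `retr` kills the vertical classes it factors through the quotient, and there it is still a
left inverse of `incl`. -/
theorem linearIndepOn_mkQ_incl (ρ₀ : Equiv.Perm (Fin m)) {S : Set (A1ab (boolGraph m) ρ₀)}
    (hS : LinearIndepOn ℤ id S) :
    LinearIndepOn ℤ (verticalSpan σ₀).mkQ (incl σ₀ ρ₀ '' S) := by
  have hle : verticalSpan σ₀ ≤ LinearMap.ker (retr σ₀ ρ₀) := fun z hz => retr_eq_zero σ₀ ρ₀ hz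
  refine LinearIndepOn.of_comp ((verticalSpan σ₀).liftQ (retr σ₀ ρ₀) hle) ?_
  have h1 : LinearIndepOn ℤ (retr σ₀ ρ₀ ∘ incl σ₀ ρ₀) S := by
    convert hS using 1
    ext z
    exact retr_incl σ₀ ρ₀ z
  exact h1.image_of_comp

/-- `A₁ᴳ(Γ(B_n), σ₀)ᵃᵇ` has a finite basis of classes of primitive `6`-cycles. -/
theorem exists_hexagon_basis (n : ℕ) (σ₀ : Equiv.Perm (Fin n)) :
    ∃ S : Set (A1ab (boolGraph n) σ₀), S ⊆ cycleClasses σ₀ (fun _ C => IsPrimitiveSixCycle C) ∧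
      S.Finite ∧ LinearIndepOn ℤ id S ∧ Submodule.span ℤ S = ⊤ := by
  induction n with
  | zero =>
    refine ⟨∅, Set.empty_subset _, Set.finite_empty, linearIndepOn_empty _ _, ?_⟩
    rw [Submodule.span_empty, eq_comm, Submodule.eq_bot_iff]
    rintro z -
    obtain ⟨f, rfl⟩ := abClass_surj z
    obtain rfl : f = BasedLoop.const _ _ := BasedLoop.ext' fun i => Subsingleton.elim _ _
    exact congrArg Additive.ofMul (map_one Abelianization.of)
  | succ m ih =>
    obtain ⟨S, hS, hfin, hind, hspan⟩ := ih 1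
    obtain ⟨T, hT, hTfin, hTind, hTspan⟩ := exists_vertical_basis σ₀
    -- A basis of the vertical part together with the included basis from one letter fewer; the
    -- latter is independent modulo the former.
    refine ⟨T ∪ incl σ₀ 1 '' S, Set.union_subset ?_ ?_, hTfin.union (hfin.image _), ?_, ?_⟩
    · intro x hx
      obtain ⟨σ, P, C, hC, rfl⟩ := hT hx
      exact ⟨σ, P, C, hC.1, rfl⟩
    · rintro _ ⟨x, hx, rfl⟩
      obtain ⟨σ, P, C, hC, h⟩ := incl_mem_topHorizontalClasses σ₀ 1 (hS hx)
      exact ⟨σ, P, C, hC.1, h⟩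
    · refine LinearIndepOn.union_id_of_quotient (M' := verticalSpan σ₀) ?_ hTind
        (linearIndepOn_mkQ_incl σ₀ 1 hind)
      exact fun x hx => Submodule.subset_span (hT hx)
    · rw [eq_top_iff]
      rintro z -
      rw [Submodule.span_union, hTspan, Submodule.span_image, hspan]
      rw [← sub_add_cancel z (incl σ₀ 1 (retr σ₀ 1 z))]
      exact Submodule.add_mem_sup (sub_incl_retr_mem σ₀ 1 z)
        (Submodule.mem_map_of_mem Submodule.mem_top)

/-- Modulo the vertical classes, erasing the largest letter is an isomorphism. -/
noncomputable def quotientEquiv (ρ₀ : Equiv.Perm (Fin m)) :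
    (A1ab (boolGraph (m + 1)) σ₀ ⧸ verticalSpan σ₀) ≃ₗ[ℤ] A1ab (boolGraph m) ρ₀ :=
  (Submodule.quotEquivOfEq _ _ (by
    ext z
    rw [verticalSpan_eq, mem_vertHexSpan_iff σ₀ ρ₀, LinearMap.mem_ker])).trans
  ((retr σ₀ ρ₀).quotKerEquivOfSurjective fun z => ⟨_, retr_incl σ₀ ρ₀ z⟩)

end Basis

end AHomotopy

/-! ### Existence and size of horizontal systems -/

theorem corollary5p6 (m : ℕ) (σ₀ : Equiv.Perm (Fin (m + 1))) (ρ₀ : Equiv.Perm (Fin m)) :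
    (∃ S : Set (AHomotopy.A1ab (AHomotopy.boolGraph (m + 1)) σ₀),
      AHomotopy.IsHorizontalSystem σ₀ S ∧
      S ⊆ AHomotopy.topHorizontalClasses σ₀ ∧
      AHomotopy.topHorizontalClasses σ₀ ⊆ (Submodule.span ℤ S : Set _)) ∧
    ∀ S : Set (AHomotopy.A1ab (AHomotopy.boolGraph (m + 1)) σ₀),
      AHomotopy.IsHorizontalSystem σ₀ S →
        S.Finite ∧
        Cardinal.mk S =
          Module.rank ℤ (AHomotopy.A1ab (AHomotopy.boolGraph m) ρ₀) := by
  open AHomotopy in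
  obtain ⟨B, hB, hfin, hind, hspan⟩ := exists_hexagon_basis m ρ₀
  have himg : Submodule.span ℤ (incl σ₀ ρ₀ '' B) = LinearMap.range (incl σ₀ ρ₀) := by
    rw [Submodule.span_image, hspan, Submodule.map_top]
  have htop : incl σ₀ ρ₀ '' B ⊆ topHorizontalClasses σ₀ := by
    rintro _ ⟨x, hx, rfl⟩
    exact incl_mem_topHorizontalClasses σ₀ ρ₀ (hB hx)
  have hhor : topHorizontalClasses σ₀ ⊆ horizontalClasses σ₀ := by
    rintro _ ⟨σ, P, C, hC, rfl⟩
    exact ⟨σ, P, C, ⟨_, hC⟩, rfl⟩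
  have hsup : LinearMap.range (incl σ₀ ρ₀) ⊔ verticalSpan σ₀ = ⊤ := by
    rw [eq_top_iff]
    rintro z -
    rw [sup_comm, ← sub_add_cancel z (incl σ₀ ρ₀ (retr σ₀ ρ₀ z)), verticalSpan_eq]
    exact Submodule.add_mem_sup (sub_incl_retr_mem σ₀ ρ₀ z) ⟨_, rfl⟩
  refine ⟨⟨incl σ₀ ρ₀ '' B, ⟨htop.trans hhor, linearIndepOn_mkQ_incl σ₀ ρ₀ hind, ?_⟩, htop, ?_⟩, ?_⟩
  · rw [himg, hsup]
    exact Set.subset_univ _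
  · intro x hx
    rw [himg]
    exact ⟨_, incl_retr_of_top σ₀ ρ₀ hx⟩
  · rintro S ⟨-, hS, hSspan⟩
    -- The system expresses all horizontal classes, in particular the included basis `B`, which
    -- together with the vertical classes generates the whole group.
    have hS' : Submodule.span ℤ S ⊔ verticalSpan σ₀ = ⊤ := by
      rw [eq_top_iff, ← hsup, ← himg]
      exact sup_le (Submodule.span_le.2 ((htop.trans hhor).trans hSspan)) le_sup_right
    have hgen : ⊤ ≤ Submodule.span ℤ (Set.range fun x : S => (verticalSpan σ₀).mkQ x) := by
      have e : Set.range (fun x : S => (verticalSpan σ₀).mkQ x) = (verticalSpan σ₀).mkQ '' S := by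
        rw [Set.image_eq_range]
      rw [e, Submodule.span_image]
      have h1 : Submodule.map (verticalSpan σ₀).mkQ (Submodule.span ℤ S ⊔ verticalSpan σ₀) = ⊤ := by
        rw [hS', Submodule.map_top, Submodule.range_mkQ]
      rw [Submodule.map_sup, Submodule.mkQ_map_self, sup_bot_eq] at h1
      exact h1.ge
    -- The images of `S` form a basis of the quotient by the vertical classes, which `quotientEquiv`
    -- carries to the group of the smaller graph.
    let b := Module.Basis.mk hS hgen
    have hrank : Cardinal.mk S = Module.rank ℤ (A1ab (boolGraph m) ρ₀) :=
      (b.map (quotientEquiv σ₀ ρ₀)).mk_eq_rank''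
    refine ⟨?_, hrank⟩
    -- The finite basis `B` shows that the rank is finite, hence so is `S`.
    have hBrank : Cardinal.mk B = Module.rank ℤ (A1ab (boolGraph m) ρ₀) := by
      refine (Module.Basis.mk (v := fun x : B => (x : A1ab (boolGraph m) ρ₀)) hind ?_).mk_eq_rank''
      rw [Subtype.range_coe, hspan]
    rw [← Cardinal.lt_aleph0_iff_set_finite, hrank, ← hBrank, Cardinal.lt_aleph0_iff_set_finite]
    exact hfin
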